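/- Let $\mathbf p=(p_1,p_2,\dots)$ be a fixed sequence in $[0,1]$ (not depending on $n$), and let $k'\ge 0$ be the largest integer such that $p_l=1$ for all $1\le l\le k'$ (so $p_{k'+1}\ne 1$). For $n\ge 1$ let $H$ be the random hypergraph on $[n]=\{1,\dots,n\}$ in which, independently, every set of $m+1\ge 2$ vertices is a hyperedge with probability $p_m$ (all vertices being present), and let $X(n,\mathbf p)$ be the largest simplicial complex contained in $H$: a nonempty $s\subseteq[n]$ is a simplex iff every $t\subseteq s$ with $|t|\ge2$ is a hyperedge. The lexicographical matching on a simplicial complex $\mathcal L$ on $[n]$ pairs a simplex $s$ with $s\cup\{i\}$, where $i$ is the smallest element of $I_{\mathcal L}(s)=\{j\in[n] : j<\min(s),\ s\cup\{j\}\in\mathcal L\}$, whenever $I_{\mathcal L}(s)\neq\varnothing$; a simplex is critical if it belongs to no pair. Let $T_{a}$ be the number of critical simplices of $X(n,\mathbf p)$ with exactly $a$ vertices (i.e. critical $(a-1)$-simplices). Put $\rho(a)=\prod_{i=k'+1}^{a}p_i^{\binom ai}$. Let $1\le i<j$ be fixed integers, put $k=k'+i$ and $r=k'+j$, and assume $p_l>0$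 for all $1\le l\le r$. Then, for all sufficiently large $n$, $\mathrm{Var}(T_{k+1})>0$ and $\mathrm{Var}(T_{r+1})>0$, and $$\lim_{n\to\infty}\frac{\mathrm{Cov}(T_{k+1},T_{r+1})}{\sqrt{\mathrm{Var}(T_{k+1})}\sqrt{\mathrm{Var}(T_{r+1})}}=\sigma_\infty,$$ where $$\sigma_\infty=\frac{\rho(k+1)\rho(r+1)\sqrt{(2-\rho(k+1))(2-\rho(r+1))(2-\rho(k+1)\rho(k'+1)^{-1})(2-\rho(r+1)\rho(k'+1)^{-1})}}{\bigl(\rho(k+1)+\rho(r+1)-\rho(k+1)\rho(r+1)\rho(k'+1)^{-1}\bigr)\bigl(\rho(k+1)+\rho(r+1)-\rho(k+1)\rho(r+1)\bigr)}.$$ Moreover $\sigma_\infty\ge 0$, and if $p_l\in(0,1)$ for all $l>k'$, then $\sigma_\infty<1$. -/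

import Mathlib

open Filter Topology MeasureTheory ProbabilityTheory
open scoped unitInterval

namespace LexMorse

noncomputable section

/-! ### The multi-parameter random simplicial complex -/

/-- The law of the indicators of the random hypergraph on the vertex set `Fin n`: independently of
each other, every set `s` of `k` vertices is a hyperedge with probability `p (k - 1)`.
Only the coordinates of sets with at least two elements are ever used: vertices are always
present in the random complex, and the empty set is never a simplex. -/
def hypergraphLaw (p : ℕ → I) (n : ℕ) : Measure (Finset (Fin n) → Bool) :=
  Measure.pi fun s => bernoulliMeasure true false (p (s.card - 1))

/-- The largest simplicial complex with vertex set `Fin n` that is contained in the hypergraph with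
indicators `H`: a nonempty `s` is a simplex iff all its subsets with at least two elements
(including `s` itself, if it has two elements or more) are hyperedges. -/
def largestComplex {n : ℕ} (H : Finset (Fin n) → Bool) : AbstractSimplicialComplex (Fin n) where
  faces := {s | s.Nonempty ∧ ∀ t ⊆ s, 2 ≤ t.card → H t = true}
  isRelLowerSet_faces := by
    rintro s ⟨hs, hH⟩
    exact ⟨hs, fun t hts ht => ⟨ht, fun u hu => hH u (hu.trans hts)⟩⟩
  singleton_mem v := by
    refine ⟨Finset.singleton_nonempty v, fun t ht h2 => ?_⟩
    have := Finset.card_le_card ht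
    simp at this
    omega

/-! ### The lexicographical matching -/

/-- `I_L(s)`: the vertices `j` with `j < min s` such that `s ∪ {j}` is a simplex of `L`. -/
def lexCandidates {n : ℕ} (L : AbstractSimplicialComplex (Fin n)) (s : Finset (Fin n)) :
    Set (Fin n) :=
  {j | (∀ v ∈ s, j < v) ∧ insert j s ∈ L}

/-- The lexicographical matching: the pairs `(s, s ∪ {i})` with `s` a simplex of `L` whose
`I_L(s)` is nonempty and `i = min I_L(s)`. -/
def lexMatching {n : ℕ} (L : AbstractSimplicialComplex (Fin n)) :
    Set (Finset (Fin n) × Finset (Fin n)) :=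
  {q | q.1 ∈ L ∧ ∃ i, IsLeast (lexCandidates L q.1) i ∧ q.2 = insert i q.1}

/-- A simplex is critical for a matching `V` if it appears in no pair of `V`. -/
def IsCritical {n : ℕ} (L : AbstractSimplicialComplex (Fin n))
    (V : Set (Finset (Fin n) × Finset (Fin n))) (t : Finset (Fin n)) : Prop :=
  t ∈ L ∧ ∀ q ∈ V, q.1 ≠ t ∧ q.2 ≠ t

open Classical in
/-- `T_a`: the number of simplices with `a` vertices (that is, of dimension `a - 1`) of the random
complex which are critical under the lexicographical matching, as a random variable. -/
def critCount {n : ℕ} (a : ℕ) (H : Finset (Fin n) → Bool) : ℝ :=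
  ((Finset.univ.filter fun t : Finset (Fin n) =>
    t.card = a ∧ IsCritical (largestComplex H) (lexMatching (largestComplex H)) t).card : ℝ)

/-! ### Covariances and their limit -/

/-- `Var(T_a)` for the complex on `n` vertices. -/
def critVar (p : ℕ → I) (n a : ℕ) : ℝ :=
  variance (critCount a) (hypergraphLaw p n)

/-- `Var(T_a)^{-1/2} Var(T_b)^{-1/2} Cov(T_a, T_b)` for the complex on `n` vertices. -/
def critCorr (p : ℕ → I) (n a b : ℕ) : ℝ :=
  (Real.sqrt (critVar p n a))⁻¹ * (Real.sqrt (critVar p n b))⁻¹ *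
    covariance (critCount a) (critCount b) (hypergraphLaw p n)

/-- `ρ(a) = ∏_{i = k'+1}^{a} p_i ^ (a choose i)`. -/
def rho (p : ℕ → I) (k' a : ℕ) : ℝ :=
  ∏ i ∈ Finset.Icc (k' + 1) a, (p i : ℝ) ^ a.choose i

/-- The closed-form expression for the limiting correlation of the counts of critical `k`- and
`r`-simplices. -/
def limitCorr (p : ℕ → I) (k' k r : ℕ) : ℝ :=
  rho p k' (k + 1) * rho p k' (r + 1) *
      Real.sqrt ((2 - rho p k' (k + 1)) * (2 - rho p k' (r + 1)) *
        (2 - rho p k' (k + 1) * (rho p k' (k' + 1))⁻¹) *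
        (2 - rho p k' (r + 1) * (rho p k' (k' + 1))⁻¹)) /
    ((rho p k' (k + 1) + rho p k' (r + 1) -
        rho p k' (k + 1) * rho p k' (r + 1) * (rho p k' (k' + 1))⁻¹) *
      (rho p k' (k + 1) + rho p k' (r + 1) - rho p k' (k + 1) * rho p k' (r + 1)))

end

end LexMorse

/-! Write U(a) for the number of a-vertex simplices to which no smaller vertex can be added and F(a)
for the number of all a-vertex simplices. The upper member of a matched pair has no candidate
vertex, and the upper members with a vertices correspond bijectively to the (a-1)-vertex simplices
that do have a candidate. Hence T_a = U(a) + U(a-1) - F(a-1) (`critCount_eq`). Almost surely every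
hyperedge with at most k'+1 vertices is present, so only those with at least k'+2 vertices matter.

Sort the simplices in U(a) by their minimum w. For the simplex {w} ∪ A, the events "it is a face"
and "j cannot be added", for j < w, use disjoint sets of hyperedges, so probabilities factor and
decay like (1 - ρ(a))^w. For two simplices with the same minimum, indicators are uncorrelated unless
|A ∩ B| ≥ k'; at |A ∩ B| = k' the covariance is an explicit difference of two w-th powers
(`cov_unmatched_eq`). For distinct minima at least k'+1 common vertices are needed, which costs a
factor n. Counting pairs with prescribed overlap (`tendsto_pairSum`) and summing over the minima by
dominated convergence gives, with a = α+1 and b = β+1, n^(k'-α-β) Cov(U(a), U(b)) → `covLimit`, a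
difference of two geometric series (`tendsto_cov_unmatchedCount`).

At the scale of U(a), the remainder U(a-1) - F(a-1) has variance of order at most n^(-2), so by
Cauchy–Schwarz it does not affect the limits (`tendsto_cov_add_add`). Normalizing `covLimit` gives
the closed form (`limitCorr_eq`).

Since p_{r+1} may vanish, ρ(r+1) = 0 is treated separately. Then U(r+1) = F(r+1) almost surely, its
variance still has the same order, and its covariance with U(k+1) is smaller by a factor n, so both
sides are 0. The bound by 1 rests on xy(2-x)(2-y) = (x+y-xy)² - (x-y)², its analogue with c⁻¹, and
ρ(r+1) < ρ(k+1). -/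

namespace LexMorse

noncomputable section

/-! ### Covariances on finite probability spaces -/

section FiniteSpace

variable {Ω : Type*} [Finite Ω] [MeasurableSpace Ω] [DiscreteMeasurableSpace Ω]
  (μ : Measure Ω) [IsProbabilityMeasure μ]

theorem cov_eq_sub_of_finite (X Y : Ω → ℝ) :
    cov[X, Y; μ] = (∫ ω, X ω * Y ω ∂μ) - (∫ ω, X ω ∂μ) * ∫ ω, Y ω ∂μ := by
  rw [covariance_eq_sub .of_discrete .of_discrete]
  rfl

/-- The variance of X + tY is a nonnegative quadratic in t, so its discriminant is at most 0. -/
theorem cov_sq_le_variance_mul (X Y : Ω → ℝ) :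
    cov[X, Y; μ] ^ 2 ≤ variance X μ * variance Y μ := by
  have h : ∀ t : ℝ, 0 ≤ variance Y μ * (t * t) + (2 * cov[X, Y; μ]) * t + variance X μ := by
    intro t
    have h1 := variance_nonneg (X + fun ω => t * Y ω) μ
    rw [variance_add .of_discrete .of_discrete, covariance_const_mul_right,
      variance_const_mul] at h1
    linarith
  have h2 := discrim_le_zero h
  unfold discrim at h2
  nlinarith

theorem abs_cov_le_sqrt_mul_sqrt (X Y : Ω → ℝ) :
    |cov[X, Y; μ]| ≤ Real.sqrt (variance X μ) * Real.sqrt (variance Y μ) := by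
  rw [← Real.sqrt_mul (variance_nonneg _ _)]
  exact Real.abs_le_sqrt (cov_sq_le_variance_mul μ X Y)

/-- Both E[XY] and E[X]E[Y] lie between 0 and E[X]. -/
theorem abs_cov_le_integral {X Y : Ω → ℝ} (hX0 : ∀ ω, 0 ≤ X ω)
    (hY0 : ∀ ω, 0 ≤ Y ω) (hY1 : ∀ ω, Y ω ≤ 1) :
    |cov[X, Y; μ]| ≤ ∫ ω, X ω ∂μ := by
  have hXi : Integrable X μ := .of_finite
  have hYi : Integrable Y μ := .of_finite
  have hXY : ∫ ω, X ω * Y ω ∂μ ≤ ∫ ω, X ω ∂μ :=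
    integral_mono .of_finite hXi fun ω => mul_le_of_le_one_right (hX0 ω) (hY1 ω)
  have hXY0 : 0 ≤ ∫ ω, X ω * Y ω ∂μ := integral_nonneg fun ω => mul_nonneg (hX0 ω) (hY0 ω)
  have hX : 0 ≤ ∫ ω, X ω ∂μ := integral_nonneg hX0
  have hY : 0 ≤ ∫ ω, Y ω ∂μ := integral_nonneg hY0
  have hY' : ∫ ω, Y ω ∂μ ≤ 1 := by
    calc ∫ ω, Y ω ∂μ ≤ ∫ _, (1 : ℝ) ∂μ := integral_mono hYi (.of_finite) hY1
      _ = 1 := by simp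
  rw [cov_eq_sub_of_finite, abs_le]
  constructor <;> nlinarith

end FiniteSpace

/-! ### Products of hyperedge indicators -/

instance (p : ℕ → I) (n : ℕ) : IsProbabilityMeasure (hypergraphLaw p n) := by
  unfold hypergraphLaw
  infer_instance

variable {n : ℕ}

/-- The indicator that all the sets in `S` are hyperedges. -/
def present (S : Finset (Finset (Fin n))) (H : Finset (Fin n) → Bool) : ℝ :=
  ∏ e ∈ S, if H e then 1 else 0

theorem present_eq_ite (S : Finset (Finset (Fin n))) (H : Finset (Fin n) → Bool) :
    present S H = if ∀ e ∈ S, H e = true then 1 else 0 := by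
  unfold present
  rw [Finset.prod_boole]
  congr

theorem present_nonneg (S : Finset (Finset (Fin n))) (H : Finset (Fin n) → Bool) :
    0 ≤ present S H := by
  rw [present_eq_ite]; split_ifs <;> norm_num

theorem present_le_one (S : Finset (Finset (Fin n))) (H : Finset (Fin n) → Bool) :
    present S H ≤ 1 := by
  rw [present_eq_ite]; split_ifs <;> norm_num

theorem present_mul_present (S T : Finset (Finset (Fin n))) (H : Finset (Fin n) → Bool) :
    present S H * present T H = present (S ∪ T) H := by
  classical
  simp only [present_eq_ite, Finset.mem_union, or_imp, forall_and]
  split_ifs <;> simp_all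

theorem dependsOn_present (S : Finset (Finset (Fin n))) :
    DependsOn (present S) (S : Set (Finset (Fin n))) := by
  intro H H' h
  unfold present
  exact Finset.prod_congr rfl fun e he => by rw [h e he]

theorem dependsOn_mul {ι : Type*} {f g : (ι → Bool) → ℝ} {S T : Set ι} (hf : DependsOn f S)
    (hg : DependsOn g T) : DependsOn (fun H => f H * g H) (S ∪ T) := fun H H' h => by
  simp only [hf fun i hi => h i (Or.inl hi), hg fun i hi => h i (Or.inr hi)]

theorem dependsOn_one_sub {ι : Type*} {f : (ι → Bool) → ℝ} {S : Set ι} (hf : DependsOn f S) :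
    DependsOn (fun H => 1 - f H) S := fun H H' h => by simp only [hf h]

theorem dependsOn_prod {ι κ : Type*} (J : Finset κ) {f : κ → (ι → Bool) → ℝ} {S : κ → Set ι}
    (hf : ∀ j ∈ J, DependsOn (f j) (S j)) :
    DependsOn (fun H => ∏ j ∈ J, f j H) (⋃ j ∈ J, S j) := fun H H' h =>
  Finset.prod_congr rfl fun j hj => hf j hj fun i hi => h i (by simpa using ⟨j, hj, hi⟩)

/-- Disjoint blocks of coordinates are independent under a product measure. All factorizations and
vanishing covariances below come down to exhibiting disjoint sets of hyperedges. -/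
theorem indepFun_of_dependsOn (p : ℕ → I) {f g : (Finset (Fin n) → Bool) → ℝ}
    {S T : Set (Finset (Fin n))} (hf : DependsOn f S) (hg : DependsOn g T) (h : Disjoint S T) :
    IndepFun f g (hypergraphLaw p n) := by
  classical
  obtain ⟨S, rfl⟩ : ∃ S' : Finset (Finset (Fin n)), (S' : Set _) = S := ⟨S.toFinset, by simp⟩
  obtain ⟨T, rfl⟩ : ∃ T' : Finset (Finset (Fin n)), (T' : Set _) = T := ⟨T.toFinset, by simp⟩
  have hi : iIndepFun (fun (e : Finset (Fin n)) (H : Finset (Fin n) → Bool) => H e)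
      (hypergraphLaw p n) := iIndepFun_pi (X := fun _ b => b) fun _ => aemeasurable_id
  have h1 := hi.indepFun_finset S T (by exact_mod_cast h) fun e => measurable_pi_apply e
  obtain ⟨f', rfl⟩ := dependsOn_iff_exists_comp.1 hf
  obtain ⟨g', rfl⟩ := dependsOn_iff_exists_comp.1 hg
  exact h1.comp (φ := f') (ψ := g') (Measurable.of_discrete) (Measurable.of_discrete)

theorem integral_mul_of_dependsOn (p : ℕ → I) {f g : (Finset (Fin n) → Bool) → ℝ}
    {S T : Set (Finset (Fin n))} (hf : DependsOn f S) (hg : DependsOn g T) (h : Disjoint S T) :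
    ∫ H, f H * g H ∂hypergraphLaw p n =
      (∫ H, f H ∂hypergraphLaw p n) * ∫ H, g H ∂hypergraphLaw p n :=
  (indepFun_of_dependsOn p hf hg h).integral_fun_mul_eq_mul_integral
    (Measurable.of_discrete).aestronglyMeasurable (Measurable.of_discrete).aestronglyMeasurable

theorem cov_eq_zero_of_dependsOn (p : ℕ → I) {f g : (Finset (Fin n) → Bool) → ℝ}
    {S T : Set (Finset (Fin n))} (hf : DependsOn f S) (hg : DependsOn g T) (h : Disjoint S T) :
    cov[f, g; hypergraphLaw p n] = 0 := by
  rw [cov_eq_sub_of_finite, integral_mul_of_dependsOn p hf hg h, sub_self]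

theorem integral_prod_of_dependsOn (p : ℕ → I) {κ : Type*} (J : Finset κ)
    {f : κ → (Finset (Fin n) → Bool) → ℝ} {S : κ → Set (Finset (Fin n))}
    (hf : ∀ j ∈ J, DependsOn (f j) (S j)) (h : (J : Set κ).PairwiseDisjoint S) :
    ∫ H, ∏ j ∈ J, f j H ∂hypergraphLaw p n = ∏ j ∈ J, ∫ H, f j H ∂hypergraphLaw p n := by
  classical
  induction J using Finset.induction_on with
  | empty => simp
  | insert a J ha ih =>
    simp only [Finset.prod_insert ha]
    rw [integral_mul_of_dependsOn p (hf a (by simp))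
      (dependsOn_prod J fun j hj => hf j (Finset.mem_insert_of_mem hj)), ih]
    · exact fun j hj => hf j (Finset.mem_insert_of_mem hj)
    · exact h.subset (by simp)
    · rw [Set.disjoint_iUnion₂_right]
      intro j hj
      exact h (by simp) (by simp [hj]) (by rintro rfl; exact ha hj)

theorem integral_present (p : ℕ → I) (S : Finset (Finset (Fin n))) :
    ∫ H, present S H ∂hypergraphLaw p n = ∏ e ∈ S, (p (e.card - 1) : ℝ) := by
  unfold present
  rw [integral_prod_of_dependsOn p S (S := fun e => {e}) (f := fun e H => if H e then 1 else 0)]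
  · refine Finset.prod_congr rfl fun e _ => ?_
    have h := integral_comp_eval
      (μ := fun s : Finset (Fin n) => bernoulliMeasure true false (p (s.card - 1))) (i := e)
      (f := fun b : Bool => if b = true then (1 : ℝ) else 0)
      (Measurable.of_discrete).aestronglyMeasurable
    rw [hypergraphLaw, h, integral_bernoulliMeasure]
    simp
  · intro e _ H H' h
    simp only [h e rfl]
  · intro a _ b _ hab
    simpa [Function.onFun] using hab

theorem ae_eq_true (p : ℕ → I) (e : Finset (Fin n)) (he : p (e.card - 1) = 1) :
    ∀ᵐ H ∂hypergraphLaw p n, H e = true := by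
  have h := (Measure.quasiMeasurePreserving_eval
    (fun s : Finset (Fin n) => bernoulliMeasure true false (p (s.card - 1))) e)
  have h2 : ∀ᵐ b ∂bernoulliMeasure true false (p (e.card - 1)), b = true := by
    rw [he, bernoulliMeasure_one]
    simp [ae_dirac_eq]
  exact h.ae h2

/-! ### Counting sets with large intersection -/

/-- Such a B is the union of an m-subset of U and β - m further points. Keeping n ^ m on the left
avoids the exponent β - m, which would truncate for m > β. -/
theorem card_filter_le_card_inter_mul_pow_le {n : ℕ} (U : Finset (Fin n)) (β m : ℕ) :
    ((Finset.univ.powersetCard β).filter fun B : Finset (Fin n) => m ≤ (B ∩ U).card).card * n ^ m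
      ≤ U.card.choose m * n ^ β := by
  classical
  by_cases hm : m ≤ β
  · have hsub : ((Finset.univ.powersetCard β).filter fun B : Finset (Fin n) => m ≤ (B ∩ U).card) ⊆
        (U.powersetCard m ×ˢ Finset.univ.powersetCard (β - m)).image fun q => q.1 ∪ q.2 := by
      intro B hB
      simp only [Finset.mem_filter, Finset.mem_powersetCard, Finset.subset_univ, true_and] at hB
      obtain ⟨C, hC, hCm⟩ := Finset.exists_subset_card_eq hB.2
      have hCB : C ⊆ B := hC.trans Finset.inter_subset_left
      simp only [Finset.mem_image, Finset.mem_product, Finset.mem_powersetCard,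
        Finset.subset_univ, true_and, Prod.exists]
      refine ⟨C, B \ C, ⟨⟨hC.trans Finset.inter_subset_right, hCm⟩, ?_⟩, by simp [hCB]⟩
      rw [Finset.card_sdiff_of_subset hCB, hB.1, hCm]
    have h1 := (Finset.card_le_card hsub).trans Finset.card_image_le
    rw [Finset.card_product, Finset.card_powersetCard, Finset.card_powersetCard,
      Finset.card_univ, Fintype.card_fin] at h1
    calc _ ≤ (U.card.choose m * n.choose (β - m)) * n ^ m := Nat.mul_le_mul_right _ h1
      _ ≤ (U.card.choose m * n ^ (β - m)) * n ^ m := by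
        gcongr
        exact Nat.choose_le_pow _ _
      _ = U.card.choose m * n ^ β := by
        rw [mul_assoc, ← pow_add, Nat.sub_add_cancel hm]
  · have : ((Finset.univ.powersetCard β).filter
        fun B : Finset (Fin n) => m ≤ (B ∩ U).card) = ∅ := by
      refine Finset.filter_false_of_mem fun B hB => ?_
      have h1 := (Finset.mem_powersetCard.1 hB).2
      have h2 := Finset.card_le_card (Finset.inter_subset_left (s₁ := B) (s₂ := U))
      omega
    simp [this]

theorem card_filter_card_inter_eq {γ : Type*} [DecidableEq γ] {A V : Finset γ} (hA : A ⊆ V)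
    {β m : ℕ} (hm : m ≤ β) :
    ((V.powersetCard β).filter fun B => (A ∩ B).card = m).card =
      A.card.choose m * (V.card - A.card).choose (β - m) := by
  rw [← Finset.card_sdiff_of_subset hA, ← Finset.card_powersetCard, ← Finset.card_powersetCard,
    ← Finset.card_product]
  refine Finset.card_nbij' (fun B => (A ∩ B, B \ A)) (fun q => q.1 ∪ q.2) ?_ ?_ ?_ ?_
  · intro B hB
    simp only [Finset.coe_filter, Finset.mem_powersetCard, Set.mem_ofPred_eq] at hB
    obtain ⟨⟨hBV, hB⟩, hAB⟩ := hB
    have := Finset.card_sdiff_add_card_inter B A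
    rw [Finset.inter_comm B A] at this
    simp only [Finset.coe_product, Set.mem_prod, Finset.mem_coe, Finset.mem_powersetCard]
    exact ⟨⟨Finset.inter_subset_left, hAB⟩, Finset.sdiff_subset_sdiff hBV le_rfl, by omega⟩
  · rintro ⟨C, D⟩ hq
    simp only [Finset.coe_product, Set.mem_prod, Finset.mem_coe, Finset.mem_powersetCard] at hq
    obtain ⟨⟨hC, hCm⟩, hD, hDm⟩ := hq
    have hdis : Disjoint A D := by
      rw [Finset.disjoint_right]; intro x hx; exact (Finset.mem_sdiff.1 (hD hx)).2
    have hAC : A ∩ (C ∪ D) = C := by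
      rw [Finset.inter_union_distrib_left, Finset.inter_eq_right.2 hC,
        Finset.disjoint_iff_inter_eq_empty.1 hdis, Finset.union_empty]
    simp only [Finset.coe_filter, Finset.mem_powersetCard, Set.mem_ofPred_eq]
    refine ⟨⟨Finset.union_subset (hC.trans hA) (hD.trans Finset.sdiff_subset), ?_⟩, ?_⟩
    · rw [Finset.card_union_of_disjoint (hdis.mono_left hC)]; omega
    · rw [hAC, hCm]
  · intro B _
    ext x
    simp only [Finset.mem_union, Finset.mem_inter, Finset.mem_sdiff]
    tauto
  · rintro ⟨C, D⟩ hq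
    simp only [Finset.coe_product, Set.mem_prod, Finset.mem_coe, Finset.mem_powersetCard] at hq
    obtain ⟨⟨hC, hCm⟩, hD, hDm⟩ := hq
    have hdis : Disjoint A D := by
      rw [Finset.disjoint_right]; intro x hx; exact (Finset.mem_sdiff.1 (hD hx)).2
    ext x
    · simp only [Finset.mem_union, Finset.mem_inter]
      have := @hC x
      have : x ∈ A → x ∉ D := fun h => Finset.disjoint_left.1 hdis h
      tauto
    · simp only [Finset.mem_union, Finset.mem_sdiff]
      have := @hC x
      have : x ∈ A → x ∉ D := fun h => Finset.disjoint_left.1 hdis h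
      tauto

/-- General error bound: each forced common vertex saves a factor n. The set `g A` is whatever B
must meet for correlation to be possible. -/
theorem sum_powersetCard_le_card_inter_mul_pow_le {n : ℕ} (V W : Finset (Fin n)) (α β m : ℕ)
    (g : Finset (Fin n) → Finset (Fin n)) {u : ℕ} (hg : ∀ A ∈ V.powersetCard α, (g A).card ≤ u)
    {c : Finset (Fin n) → Finset (Fin n) → ℝ} {θ : ℝ} (hθ : 0 ≤ θ)
    (hzero : ∀ A ∈ V.powersetCard α, ∀ B ∈ W.powersetCard β, (B ∩ g A).card < m → c A B = 0)
    (hle : ∀ A ∈ V.powersetCard α, ∀ B ∈ W.powersetCard β, |c A B| ≤ θ) :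
    |∑ A ∈ V.powersetCard α, ∑ B ∈ W.powersetCard β, c A B| * n ^ m ≤
      θ * u.choose m * n ^ (α + β) := by
  have hin : ∀ A ∈ V.powersetCard α,
      (∑ B ∈ W.powersetCard β, |c A B|) * n ^ m ≤ θ * u.choose m * n ^ β := by
    intro A hA
    have hcard := (card_filter_le_card_inter_mul_pow_le (g A) β m).trans
      (Nat.mul_le_mul_right _ (Nat.choose_le_choose m (hg A hA)))
    have hcard' : ((((Finset.univ : Finset (Fin n)).powersetCard β).filter
      fun B : Finset (Fin n) => m ≤ (B ∩ g A).card).card : ℝ) * n ^ m ≤ u.choose m * n ^ β := by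
      exact_mod_cast hcard
    calc (∑ B ∈ W.powersetCard β, |c A B|) * n ^ m
        ≤ (∑ B ∈ W.powersetCard β,
            if m ≤ (B ∩ g A).card then θ else 0) * n ^ m := by
          gcongr with B hB
          split_ifs with h
          · exact hle A hA B hB
          · rw [hzero A hA B hB (by omega), abs_zero]
      _ ≤ (∑ B ∈ (Finset.univ : Finset (Fin n)).powersetCard β,
            if m ≤ (B ∩ g A).card then θ else 0) * n ^ m := by
          refine mul_le_mul_of_nonneg_right ?_ (by positivity)
          refine Finset.sum_le_sum_of_subset_of_nonneg
            (Finset.powersetCard_mono (Finset.subset_univ W)) fun B _ _ => ?_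
          split_ifs <;> simp [hθ]
      _ = θ * ((((Finset.univ : Finset (Fin n)).powersetCard β).filter
            fun B : Finset (Fin n) => m ≤ (B ∩ g A).card).card * n ^ m) := by
          rw [← Finset.sum_filter, Finset.sum_const, nsmul_eq_mul]; ring
      _ ≤ θ * (u.choose m * n ^ β) := by gcongr
      _ = _ := by ring
  calc |∑ A ∈ V.powersetCard α, ∑ B ∈ W.powersetCard β, c A B| * n ^ m
      ≤ (∑ A ∈ V.powersetCard α, ∑ B ∈ W.powersetCard β, |c A B|) * n ^ m := by
        gcongr
        exact (Finset.abs_sum_le_sum_abs _ _).trans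
          (Finset.sum_le_sum fun _ _ => Finset.abs_sum_le_sum_abs _ _)
    _ = ∑ A ∈ V.powersetCard α, (∑ B ∈ W.powersetCard β, |c A B|) * n ^ m := by
        rw [Finset.sum_mul]
    _ ≤ ∑ A ∈ V.powersetCard α, θ * u.choose m * n ^ β := Finset.sum_le_sum hin
    _ = (V.card.choose α : ℝ) * (θ * u.choose m * n ^ β) := by
        rw [Finset.sum_const, Finset.card_powersetCard, nsmul_eq_mul]
    _ ≤ (n ^ α : ℝ) * (θ * u.choose m * n ^ β) := by
        gcongr
        have h1 : V.card ≤ n := by simpa using Finset.card_le_univ V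
        exact_mod_cast (Nat.choose_le_pow _ _).trans (Nat.pow_le_pow_left h1 _)
    _ = _ := by ring

theorem sum_powersetCard_card_inter_eq {n : ℕ} (V : Finset (Fin n)) {α β m : ℕ} (hm : m ≤ β)
    (K : ℝ) :
    ∑ A ∈ V.powersetCard α, ∑ B ∈ V.powersetCard β, (if (A ∩ B).card = m then K else 0) =
      K * (V.card.choose α * (α.choose m * (V.card - α).choose (β - m))) := by
  have : ∀ A ∈ V.powersetCard α,
      ∑ B ∈ V.powersetCard β, (if (A ∩ B).card = m then K else 0) =
        K * (α.choose m * (V.card - α).choose (β - m)) := by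
    intro A hA
    obtain ⟨hA1, hA2⟩ := Finset.mem_powersetCard.1 hA
    rw [← Finset.sum_filter, Finset.sum_const, card_filter_card_inter_eq hA1 hm, hA2,
      nsmul_eq_mul]
    push_cast
    ring
  rw [Finset.sum_congr rfl this, Finset.sum_const, Finset.card_powersetCard, nsmul_eq_mul]
  ring

/-! ### Asymptotics of pair sums -/

theorem tendsto_choose_div_pow {N : ℕ → ℕ}
    (hN : Tendsto (fun n => (N n : ℝ) / n) atTop (𝓝 1)) (α : ℕ) :
    Tendsto (fun n => ((N n).choose α : ℝ) / n ^ α) atTop (𝓝 (1 / α.factorial)) := by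
  have hNtop : Tendsto N atTop atTop := by
    have : Tendsto (fun n => (N n : ℝ) / n * n) atTop atTop :=
      hN.pos_mul_atTop one_pos tendsto_natCast_atTop_atTop
    rw [← tendsto_natCast_atTop_iff (R := ℝ)]
    refine this.congr' ?_
    filter_upwards [eventually_gt_atTop 0] with n hn
    field_simp
  have h1 : Tendsto (fun k : ℕ => (k.choose α : ℝ) / (k ^ α / α.factorial)) atTop (𝓝 1) := by
    refine (Asymptotics.isEquivalent_iff_tendsto_one ?_).1 (isEquivalent_choose α)
    filter_upwards [eventually_gt_atTop 0] with k hk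
    positivity
  have h2 := (h1.comp hNtop).mul ((hN.pow α).mul_const (1 / (α.factorial : ℝ)))
  simp only [one_pow, one_mul] at h2
  refine h2.congr' ?_
  filter_upwards [eventually_gt_atTop 0, hNtop.eventually_gt_atTop 0] with n hn hNn
  simp only [Function.comp]
  have : (0 : ℝ) < N n := by exact_mod_cast hNn
  rw [div_pow]
  field_simp

theorem tendsto_sub_const_div {N : ℕ → ℕ}
    (hN : Tendsto (fun n => (N n : ℝ) / n) atTop (𝓝 1)) (k : ℕ) :
    Tendsto (fun n => ((N n - k : ℕ) : ℝ) / n) atTop (𝓝 1) := by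
  have h0 : Tendsto (fun n : ℕ => (k : ℝ) / n) atTop (𝓝 0) :=
    tendsto_const_nhds.div_atTop tendsto_natCast_atTop_atTop
  have h1 := hN.sub h0
  rw [sub_zero] at h1
  refine tendsto_of_tendsto_of_tendsto_of_le_of_le h1 hN ?_ ?_
  · intro n
    simp only
    rw [← sub_div]
    gcongr
    rw [sub_le_iff_le_add]
    exact_mod_cast (by omega : N n ≤ N n - k + k)
  · intro n
    simp only
    gcongr
    omega

/-- Pairs with overlap exactly m dominate: smaller overlaps contribute nothing, and larger ones are
too few by a factor n, so their exact contribution is irrelevant once it is bounded. -/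
theorem tendsto_pairSum {α β m : ℕ} (hmβ : m ≤ β) (K : ℝ)
    {V : ∀ n, Finset (Fin n)}
    (hV : Tendsto (fun n => ((V n).card : ℝ) / n) atTop (𝓝 1))
    {c : ∀ n, Finset (Fin n) → Finset (Fin n) → ℝ} {M : ℝ}
    (hzero : ∀ᶠ n in atTop, ∀ A ∈ (V n).powersetCard α, ∀ B ∈ (V n).powersetCard β,
      (A ∩ B).card < m → c n A B = 0)
    (heq : ∀ᶠ n in atTop, ∀ A ∈ (V n).powersetCard α, ∀ B ∈ (V n).powersetCard β,
      (A ∩ B).card = m → c n A B = K)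
    (hle : ∀ᶠ n in atTop, ∀ A ∈ (V n).powersetCard α, ∀ B ∈ (V n).powersetCard β,
      |c n A B| ≤ M) :
    Tendsto (fun n : ℕ => (∑ A ∈ (V n).powersetCard α, ∑ B ∈ (V n).powersetCard β, c n A B)
      * n ^ m / n ^ (α + β)) atTop
      (𝓝 (K * (α.choose m / (α.factorial * (β - m).factorial)))) := by
  have hmain : Tendsto (fun n : ℕ => (∑ A ∈ (V n).powersetCard α, ∑ B ∈ (V n).powersetCard β,
      (if (A ∩ B).card = m then K else 0)) * n ^ m / n ^ (α + β)) atTop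
      (𝓝 (K * (α.choose m / (α.factorial * (β - m).factorial)))) := by
    have h1 := ((tendsto_choose_div_pow hV α).mul
      (tendsto_choose_div_pow (tendsto_sub_const_div hV α) (β - m))).const_mul
        (K * α.choose m)
    have h2 : K * (α.choose m : ℝ) * (1 / α.factorial * (1 / (β - m).factorial)) =
        K * (α.choose m / (α.factorial * (β - m).factorial)) := by
      field_simp
    rw [h2] at h1
    refine h1.congr' ?_
    filter_upwards [eventually_gt_atTop 0] with n hn
    rw [sum_powersetCard_card_inter_eq _ hmβ]
    have hn' : (n : ℝ) ≠ 0 := by positivity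
    have : (n : ℝ) ^ (α + β) = n ^ α * (n ^ (β - m) * n ^ m) := by
      rw [← pow_add, ← pow_add]; congr 1; omega
    rw [this]
    field_simp
  have herr : Tendsto (fun n : ℕ => (∑ A ∈ (V n).powersetCard α, ∑ B ∈ (V n).powersetCard β,
      (c n A B - if (A ∩ B).card = m then K else 0)) * n ^ m / n ^ (α + β)) atTop (𝓝 0) := by
    have hz : Tendsto (fun n : ℕ => ((|M| + |K|) * α.choose (m + 1)) / n) atTop (𝓝 0) :=
      tendsto_const_nhds.div_atTop tendsto_natCast_atTop_atTop
    refine squeeze_zero_norm' ?_ hz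
    filter_upwards [eventually_gt_atTop 0, hzero, heq, hle] with n hn h0 h1 h2
    -- After the constant K is subtracted, overlap m contributes nothing either, so the counting
    -- bound applies with m + 1.
    have key := sum_powersetCard_le_card_inter_mul_pow_le (V n) (V n) α β (m + 1)
      id (u := α) (fun A hA => (Finset.mem_powersetCard.1 hA).2.le)
      (c := fun A B => c n A B - if (A ∩ B).card = m then K else 0) (θ := |M| + |K|)
      (by positivity) ?_ ?_
    · have hn' : (0 : ℝ) < n := by positivity
      rw [Real.norm_eq_abs, abs_div, abs_mul, abs_of_pos (a := (n : ℝ) ^ m) (by positivity),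
        abs_of_pos (a := (n : ℝ) ^ (α + β)) (by positivity), div_le_div_iff₀ (by positivity) hn']
      rw [pow_succ] at key
      linarith
    · intro A hA B hB hAB
      rw [id, Finset.inter_comm] at hAB
      rcases Nat.lt_succ_iff_lt_or_eq.1 hAB with h | h
      · simp [h0 A hA B hB h, h.ne]
      · simp [h1 A hA B hB h, h]
    · intro A hA B hB
      refine (abs_sub _ _).trans (add_le_add ((h2 A hA B hB).trans (le_abs_self M)) ?_)
      split_ifs <;> simp
  have := hmain.add herr
  rw [add_zero] at this
  refine this.congr fun n => ?_
  simp only [Finset.sum_sub_distrib]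
  ring

/-! ### Hyperedges below a simplex and its one-point extensions -/

/-- The subsets of `t` with at least `m` elements. -/
def edgesIn (m : ℕ) (t : Finset (Fin n)) : Finset (Finset (Fin n)) :=
  t.powerset.filter fun e => m ≤ e.card

/-- The sets `u ∪ {j}` with at least `m` elements, for `u ⊆ t`. -/
def cone (m : ℕ) (j : Fin n) (t : Finset (Fin n)) : Finset (Finset (Fin n)) :=
  (t.powerset.filter fun u => m ≤ u.card + 1).image (insert j)

theorem mem_edgesIn {m : ℕ} {t e : Finset (Fin n)} : e ∈ edgesIn m t ↔ e ⊆ t ∧ m ≤ e.card := by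
  simp [edgesIn]

theorem mem_cone {m : ℕ} {j : Fin n} {t e : Finset (Fin n)} (hj : j ∉ t) :
    e ∈ cone m j t ↔ j ∈ e ∧ e ⊆ insert j t ∧ m ≤ e.card := by
  simp only [cone, Finset.mem_image, Finset.mem_filter, Finset.mem_powerset]
  constructor
  · rintro ⟨u, ⟨hu, hm⟩, rfl⟩
    refine ⟨Finset.mem_insert_self _ _, Finset.insert_subset_insert _ hu, ?_⟩
    rwa [Finset.card_insert_of_notMem fun h => hj (hu h)]
  · rintro ⟨hje, het, hm⟩
    refine ⟨e.erase j, ⟨Finset.subset_insert_iff.1 het, ?_⟩, Finset.insert_erase hje⟩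
    rwa [Finset.card_erase_add_one hje]

theorem edgesIn_inter (m : ℕ) (t t' : Finset (Fin n)) :
    edgesIn m t ∩ edgesIn m t' = edgesIn m (t ∩ t') := by
  ext e
  simp only [Finset.mem_inter, mem_edgesIn, Finset.subset_inter_iff]
  tauto

theorem cone_inter (m : ℕ) {j : Fin n} {t t' : Finset (Fin n)} (hj : j ∉ t) (hj' : j ∉ t') :
    cone m j t ∩ cone m j t' = cone m j (t ∩ t') := by
  ext e
  have : j ∉ t ∩ t' := fun h => hj (Finset.mem_inter.1 h).1
  simp only [Finset.mem_inter, mem_cone hj, mem_cone hj', mem_cone this,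
    Finset.insert_inter_distrib, Finset.subset_inter_iff]
  tauto

/-- The probability that a set of `a` vertices is a simplex, if all hyperedges with fewer than
`k' + 2` vertices are present. -/
def faceProb (p : ℕ → I) (k' a : ℕ) : ℝ :=
  ∏ i ∈ Finset.Icc (k' + 2) a, (p (i - 1) : ℝ) ^ a.choose i

theorem prod_filter_powerset_card {γ : Type*} (t : Finset γ) (m : ℕ) (f : ℕ → ℝ) :
    ∏ u ∈ t.powerset.filter (fun u => m ≤ u.card), f u.card =
      ∏ i ∈ Finset.Icc m t.card, f i ^ t.card.choose i := by
  rw [Finset.prod_filter, Finset.prod_powerset, Finset.prod_congr rfl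
      (g := fun i => (if m ≤ i then f i else 1) ^ t.card.choose i),
    ← Finset.prod_subset (s₁ := Finset.Icc m t.card)]
  · refine Finset.prod_congr rfl fun i hi => ?_
    rw [if_pos (Finset.mem_Icc.1 hi).1]
  · intro i hi
    have := Finset.mem_Icc.1 hi
    exact Finset.mem_range.2 (by omega)
  · intro i hi hi'
    have h1 := Finset.mem_range.1 hi
    rw [Finset.mem_Icc, not_and_or] at hi'
    rw [if_neg (by omega), one_pow]
  · intro i _
    rw [← Finset.card_powersetCard, ← Finset.prod_const]
    exact Finset.prod_congr rfl fun u hu => by rw [(Finset.mem_powersetCard.1 hu).2]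

theorem prod_edgesIn (p : ℕ → I) (k' : ℕ) (t : Finset (Fin n)) :
    ∏ e ∈ edgesIn (k' + 2) t, (p (e.card - 1) : ℝ) = faceProb p k' t.card :=
  prod_filter_powerset_card t (k' + 2) fun i => (p (i - 1) : ℝ)

theorem prod_cone (p : ℕ → I) (k' : ℕ) {j : Fin n} {t : Finset (Fin n)} (hj : j ∉ t) :
    ∏ e ∈ cone (k' + 2) j t, (p (e.card - 1) : ℝ) = rho p k' t.card := by
  rw [cone, Finset.prod_image]
  · rw [rho, ← prod_filter_powerset_card t (k' + 1) fun i => (p i : ℝ)]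
    refine Finset.prod_congr (by ext u; simp) fun u hu => ?_
    have hu' : u ⊆ t := Finset.mem_powerset.1 (Finset.mem_filter.1 hu).1
    rw [Finset.card_insert_of_notMem fun h => hj (hu' h), Nat.add_sub_cancel]
  · intro u hu v hv huv
    have hu' : u ⊆ t := Finset.mem_powerset.1 (Finset.mem_filter.1 hu).1
    have hv' : v ⊆ t := Finset.mem_powerset.1 (Finset.mem_filter.1 hv).1
    rw [← Finset.erase_insert fun h => hj (hu' h), ← Finset.erase_insert fun h => hj (hv' h)]
    exact congrArg (fun s => Finset.erase s j) huv

/-- The quotient form of P(S ∪ T) is the source of the factor ρ(k'+1)⁻¹ in the limit. -/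
theorem integral_present_mul (p : ℕ → I) {S T : Finset (Finset (Fin n))}
    (h : ∏ e ∈ S ∩ T, (p (e.card - 1) : ℝ) ≠ 0) :
    ∫ H, present S H * present T H ∂hypergraphLaw p n =
      (∏ e ∈ S, (p (e.card - 1) : ℝ)) * (∏ e ∈ T, (p (e.card - 1) : ℝ)) /
        ∏ e ∈ S ∩ T, (p (e.card - 1) : ℝ) := by
  simp only [present_mul_present]
  rw [integral_present, eq_div_iff h, Finset.prod_union_inter]

/-! ### Simplices without a candidate vertex -/

/-- The indicator that `{w} ∪ A` is a simplex and no vertex below `w` can be added to it, where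
only hyperedges with at least `m` vertices are taken into account. -/
def unmatched (m : ℕ) (w : Fin n) (A : Finset (Fin n)) (H : Finset (Fin n) → Bool) : ℝ :=
  present (edgesIn m (insert w A)) H *
    ∏ j ∈ Finset.Iio w, (1 - present (cone m j (insert w A)) H)

theorem present_eq_zero_or_one (S : Finset (Finset (Fin n))) (H : Finset (Fin n) → Bool) :
    present S H = 0 ∨ present S H = 1 := by
  rw [present_eq_ite]; split_ifs <;> simp

theorem unmatched_eq_zero_or_one (m : ℕ) (w : Fin n) (A : Finset (Fin n))
    (H : Finset (Fin n) → Bool) : unmatched m w A H = 0 ∨ unmatched m w A H = 1 := by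
  have h : ∀ s : Finset (Fin n), ∏ j ∈ s, (1 - present (cone m j (insert w A)) H) = 0 ∨
      ∏ j ∈ s, (1 - present (cone m j (insert w A)) H) = 1 := by
    intro s
    induction s using Finset.induction_on with
    | empty => simp
    | insert a s ha ih =>
      rw [Finset.prod_insert ha]
      rcases ih with ih | ih <;> rcases present_eq_zero_or_one (cone m a (insert w A)) H with h | h
        <;> simp [ih, h]
  unfold unmatched
  rcases h (Finset.Iio w) with ih | ih <;>
    rcases present_eq_zero_or_one (edgesIn m (insert w A)) H with h | h <;> simp [ih, h]

theorem unmatched_nonneg (m : ℕ) (w : Fin n) (A : Finset (Fin n)) (H : Finset (Fin n) → Bool) :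
    0 ≤ unmatched m w A H := by
  rcases unmatched_eq_zero_or_one m w A H with h | h <;> simp [h]

theorem unmatched_le_one (m : ℕ) (w : Fin n) (A : Finset (Fin n)) (H : Finset (Fin n) → Bool) :
    unmatched m w A H ≤ 1 := by
  rcases unmatched_eq_zero_or_one m w A H with h | h <;> simp [h]

theorem notMem_insert_of_lt {w j : Fin n} {A : Finset (Fin n)} (hA : A ⊆ Finset.Ioi w)
    (hj : j < w) : j ∉ insert w A := by
  rw [Finset.mem_insert]
  rintro (rfl | h)
  · exact lt_irrefl _ hj
  · exact lt_asymm hj (Finset.mem_Ioi.1 (hA h))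

theorem le_of_mem_insert {w x : Fin n} {A : Finset (Fin n)} (hA : A ⊆ Finset.Ioi w)
    (hx : x ∈ insert w A) : w ≤ x := by
  rcases Finset.mem_insert.1 hx with rfl | h
  · exact le_rfl
  · exact (Finset.mem_Ioi.1 (hA h)).le

theorem dependsOn_present_edgesIn (m : ℕ) {w : Fin n} {A : Finset (Fin n)}
    (hA : A ⊆ Finset.Ioi w) :
    DependsOn (present (edgesIn m (insert w A))) {e : Finset (Fin n) | ∀ x ∈ e, w ≤ x} :=
  (dependsOn_present _).mono fun _ he _ hx =>
    le_of_mem_insert hA ((mem_edgesIn.1 he).1 hx)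

theorem dependsOn_present_cone (m : ℕ) {w j : Fin n} {A : Finset (Fin n)}
    (hA : A ⊆ Finset.Ioi w) (hj : j < w) :
    DependsOn (present (cone m j (insert w A)))
      {e : Finset (Fin n) | j ∈ e ∧ ∀ x ∈ e, x < w → x = j} := by
  refine (dependsOn_present _).mono fun e he => ?_
  obtain ⟨h1, h2, -⟩ := (mem_cone (notMem_insert_of_lt hA hj)).1 he
  refine ⟨h1, fun x hx hxw => ?_⟩
  rcases Finset.mem_insert.1 (h2 hx) with h | h
  · exact h
  · exact absurd (le_of_mem_insert hA h) (not_le.2 hxw)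

/-- Hyperedges inside the two simplices have no vertex below w, while those in a cone at j < w have
j as their only vertex below w. These families are disjoint for both simplices simultaneously, hence
the product over j. -/
theorem integral_unmatched_mul_unmatched (p : ℕ → I) (m : ℕ) {w : Fin n} {A B : Finset (Fin n)}
    (hA : A ⊆ Finset.Ioi w) (hB : B ⊆ Finset.Ioi w) :
    ∫ H, unmatched m w A H * unmatched m w B H ∂hypergraphLaw p n =
      (∫ H, present (edgesIn m (insert w A)) H * present (edgesIn m (insert w B)) H
        ∂hypergraphLaw p n) *
      ∏ j ∈ Finset.Iio w, ∫ H, (1 - present (cone m j (insert w A)) H) *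
        (1 - present (cone m j (insert w B)) H) ∂hypergraphLaw p n := by
  have hD : ∀ j ∈ Finset.Iio w, DependsOn (fun H => (1 - present (cone m j (insert w A)) H) *
      (1 - present (cone m j (insert w B)) H))
      {e : Finset (Fin n) | j ∈ e ∧ ∀ x ∈ e, x < w → x = j} := by
    intro j hj
    rw [Finset.mem_Iio] at hj
    have := dependsOn_mul (dependsOn_one_sub (dependsOn_present_cone m hA hj))
      (dependsOn_one_sub (dependsOn_present_cone m hB hj))
    rwa [Set.union_self] at this
  have hE := dependsOn_mul (dependsOn_present_edgesIn m hA) (dependsOn_present_edgesIn m hB)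
  rw [Set.union_self] at hE
  rw [← integral_prod_of_dependsOn p _ hD, ← integral_mul_of_dependsOn p hE (dependsOn_prod _ hD)]
  · refine integral_congr_ae (.of_forall fun H => ?_)
    simp only [unmatched, Finset.prod_mul_distrib]
    ring
  · rw [Set.disjoint_iUnion₂_right]
    intro j hj
    rw [Set.disjoint_left]
    intro e he he'
    exact absurd (he j he'.1) (not_le.2 (Finset.mem_Iio.1 hj))
  · intro j hj j' hj' hne
    rw [Function.onFun, Set.disjoint_left]
    intro e he he'
    exact hne (he'.2 j he.1 (Finset.mem_Iio.1 hj))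

theorem integral_one_sub_mul_one_sub (p : ℕ → I) (f g : (Finset (Fin n) → Bool) → ℝ) :
    ∫ H, (1 - f H) * (1 - g H) ∂hypergraphLaw p n =
      1 - (∫ H, f H ∂hypergraphLaw p n) - (∫ H, g H ∂hypergraphLaw p n) +
        ∫ H, f H * g H ∂hypergraphLaw p n := by
  have : ∀ H, (1 - f H) * (1 - g H) = 1 - f H - g H + f H * g H := fun H => by ring
  simp only [this]
  rw [integral_add .of_finite .of_finite, integral_sub .of_finite .of_finite,
    integral_sub .of_finite .of_finite]
  simp

theorem integral_unmatched (p : ℕ → I) (k' : ℕ) {w : Fin n} {A : Finset (Fin n)}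
    (hA : A ⊆ Finset.Ioi w) :
    ∫ H, unmatched (k' + 2) w A H ∂hypergraphLaw p n =
      faceProb p k' (A.card + 1) * (1 - rho p k' (A.card + 1)) ^ (w : ℕ) := by
  have hw : w ∉ A := fun h => lt_irrefl _ (Finset.mem_Ioi.1 (hA h))
  -- An indicator equals its square, so the mean is the case B = A of the product formula.
  have h1 : ∀ H, unmatched (k' + 2) w A H =
      unmatched (k' + 2) w A H * unmatched (k' + 2) w A H := fun H => by
    rcases unmatched_eq_zero_or_one (k' + 2) w A H with h | h <;> simp [h]
  rw [integral_congr_ae (.of_forall h1), integral_unmatched_mul_unmatched p _ hA hA]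
  simp only [integral_one_sub_mul_one_sub, present_mul_present, Finset.union_self,
    integral_present, prod_edgesIn, Finset.card_insert_of_notMem hw]
  congr 1
  rw [Finset.prod_congr rfl (g := fun _ => 1 - rho p k' (A.card + 1)), Finset.prod_const,
    Fin.card_Iio]
  intro j hj
  rw [prod_cone p k' (notMem_insert_of_lt hA (Finset.mem_Iio.1 hj)),
    Finset.card_insert_of_notMem hw]
  ring

theorem rho_self (p : ℕ → I) (k' : ℕ) : rho p k' (k' + 1) = p (k' + 1) := by
  simp [rho]

/-- The simplices share k'+1 vertices, too few to contain a relevant hyperedge, so the two face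
events are independent. For each j < w, however, the shared vertices together with j form one
hyperedge lying in both cones, of probability p_{k'+1} = ρ(k'+1). This is the only source of
correlation. -/
theorem cov_unmatched_eq (p : ℕ → I) (k' : ℕ) (hc : (p (k' + 1) : ℝ) ≠ 0) {w : Fin n}
    {A B : Finset (Fin n)} (hA : A ⊆ Finset.Ioi w) (hB : B ⊆ Finset.Ioi w)
    (hAB : (A ∩ B).card = k') :
    cov[unmatched (k' + 2) w A, unmatched (k' + 2) w B; hypergraphLaw p n] =
      faceProb p k' (A.card + 1) * faceProb p k' (B.card + 1) *
      ((1 - rho p k' (A.card + 1) - rho p k' (B.card + 1) +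
          rho p k' (A.card + 1) * rho p k' (B.card + 1) / rho p k' (k' + 1)) ^ (w : ℕ) -
        ((1 - rho p k' (A.card + 1)) * (1 - rho p k' (B.card + 1))) ^ (w : ℕ)) := by
  have hwA : w ∉ A := fun h => lt_irrefl _ (Finset.mem_Ioi.1 (hA h))
  have hwB : w ∉ B := fun h => lt_irrefl _ (Finset.mem_Ioi.1 (hB h))
  have hI : (insert w A ∩ insert w B).card = k' + 1 := by
    rw [← Finset.insert_inter_distrib, Finset.card_insert_of_notMem
      fun h => hwA (Finset.mem_inter.1 h).1, hAB]
  have hE : edgesIn (k' + 2) (insert w A) ∩ edgesIn (k' + 2) (insert w B) = ∅ := by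
    rw [edgesIn_inter, Finset.eq_empty_iff_forall_notMem]
    intro e he
    rw [mem_edgesIn] at he
    have := Finset.card_le_card he.1
    omega
  rw [cov_eq_sub_of_finite, integral_unmatched p k' hA, integral_unmatched p k' hB,
    integral_unmatched_mul_unmatched p _ hA hB, integral_present_mul p (by simp [hE]), hE,
    prod_edgesIn, prod_edgesIn, Finset.card_insert_of_notMem hwA, Finset.card_insert_of_notMem hwB]
  rw [Finset.prod_empty, Finset.prod_congr rfl (g := fun _ =>
      1 - rho p k' (A.card + 1) - rho p k' (B.card + 1) +
        rho p k' (A.card + 1) * rho p k' (B.card + 1) / rho p k' (k' + 1)), Finset.prod_const,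
    Fin.card_Iio, mul_pow]
  · ring
  · intro j hj
    have hjA := notMem_insert_of_lt hA (Finset.mem_Iio.1 hj)
    have hjB := notMem_insert_of_lt hB (Finset.mem_Iio.1 hj)
    have hC : ∏ e ∈ cone (k' + 2) j (insert w A) ∩ cone (k' + 2) j (insert w B),
        (p (e.card - 1) : ℝ) = rho p k' (k' + 1) := by
      rw [cone_inter _ hjA hjB, prod_cone p k' fun h => hjA (Finset.mem_inter.1 h).1, hI]
    rw [integral_one_sub_mul_one_sub, integral_present_mul p (by rw [hC, rho_self]; exact hc), hC,
      integral_present, integral_present, prod_cone p k' hjA, prod_cone p k' hjB,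
      Finset.card_insert_of_notMem hwA, Finset.card_insert_of_notMem hwB]

/-- The hyperedges on which `unmatched m w A` depends. -/
def relevant (m : ℕ) (w : Fin n) (A : Finset (Fin n)) : Set (Finset (Fin n)) :=
  {e | m ≤ e.card ∧ ∃ j ≤ w, e ⊆ insert j (insert w A)}

theorem dependsOn_unmatched (m : ℕ) {w : Fin n} {A : Finset (Fin n)} (hA : A ⊆ Finset.Ioi w) :
    DependsOn (unmatched m w A) (relevant m w A) := by
  have h := dependsOn_mul (dependsOn_present (edgesIn m (insert w A)))
    (dependsOn_prod (Finset.Iio w) fun j _ => dependsOn_one_sub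
      (dependsOn_present (cone m j (insert w A))))
  refine h.mono (Set.union_subset ?_ ?_)
  · intro e he
    have := mem_edgesIn.1 he
    exact ⟨this.2, w, le_rfl, this.1.trans (Finset.subset_insert _ _)⟩
  · refine Set.iUnion₂_subset fun j hj e he => ?_
    have hj' := Finset.mem_Iio.1 hj
    have := (mem_cone (notMem_insert_of_lt hA hj')).1 he
    exact ⟨this.2.2, j, hj'.le, this.2.1⟩

/-- A hyperedge relevant to both has at least k'+2 vertices, and at most two of them, j' and w, lie
outside A ∩ B. -/
theorem cov_unmatched_eq_zero_of_card_inter_lt (p : ℕ → I) (k' : ℕ) {w : Fin n}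
    {A B : Finset (Fin n)} (hA : A ⊆ Finset.Ioi w) (hB : B ⊆ Finset.Ioi w)
    (hAB : (A ∩ B).card < k') :
    cov[unmatched (k' + 2) w A, unmatched (k' + 2) w B; hypergraphLaw p n] = 0 := by
  refine cov_eq_zero_of_dependsOn p (dependsOn_unmatched _ hA) (dependsOn_unmatched _ hB) ?_
  rw [Set.disjoint_left]
  rintro e ⟨hm, j, hj, he⟩ ⟨-, j', hj', he'⟩
  have hsub : (e.erase j').erase w ⊆ A ∩ B := by
    intro x hx
    simp only [Finset.mem_erase] at hx
    obtain ⟨hxw, hxj', hxe⟩ := hx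
    have h1 := he hxe
    have h2 := he' hxe
    simp only [Finset.mem_insert, hxw, hxj', false_or] at h1 h2
    refine Finset.mem_inter.2 ⟨h1.resolve_left ?_, h2⟩
    rintro rfl
    exact absurd (Finset.mem_Ioi.1 (hB h2)) (not_lt.2 hj)
  have h1 := Finset.card_le_card hsub
  have h2 := Finset.pred_card_le_card_erase (s := e) (a := j')
  have h3 := Finset.pred_card_le_card_erase (s := e.erase j') (a := w)
  omega

/-- All vertices of a common hyperedge other than j' are at least w' > w, so they are forced into A.
Only one vertex is exceptional, instead of two for equal minima; this raises the required overlap to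
k'+1. -/
theorem cov_unmatched_eq_zero_of_lt (p : ℕ → I) (k' : ℕ) {w w' : Fin n} (hw : w < w')
    {A B : Finset (Fin n)} (hA : A ⊆ Finset.Ioi w) (hB : B ⊆ Finset.Ioi w')
    (hAB : (A ∩ insert w' B).card < k' + 1) :
    cov[unmatched (k' + 2) w A, unmatched (k' + 2) w' B; hypergraphLaw p n] = 0 := by
  refine cov_eq_zero_of_dependsOn p (dependsOn_unmatched _ hA) (dependsOn_unmatched _ hB) ?_
  rw [Set.disjoint_left]
  rintro e ⟨hm, j, hj, he⟩ ⟨-, j', hj', he'⟩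
  have hsub : e.erase j' ⊆ A ∩ insert w' B := by
    intro x hx
    obtain ⟨hxj', hxe⟩ := Finset.mem_erase.1 hx
    have h2 : x ∈ insert w' B := (Finset.mem_insert.1 (he' hxe)).resolve_left hxj'
    have h3 : w < x := hw.trans_le (le_of_mem_insert hB h2)
    have h1 := he hxe
    simp only [Finset.mem_insert, h3.ne', (hj.trans_lt h3).ne', false_or] at h1
    exact Finset.mem_inter.2 ⟨h1, h2⟩
  have h1 := Finset.card_le_card hsub
  have h2 := Finset.pred_card_le_card_erase (s := e) (a := j')
  omega

theorem cov_unmatched_present_eq_zero (p : ℕ → I) (m : ℕ) {w : Fin n}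
    {A t : Finset (Fin n)} (hA : A ⊆ Finset.Ioi w)
    (h : (t ∩ (A ∪ Finset.Iic w)).card < m) :
    cov[unmatched m w A, present (edgesIn m t); hypergraphLaw p n] = 0 := by
  refine cov_eq_zero_of_dependsOn p (dependsOn_unmatched _ hA) (dependsOn_present _) ?_
  rw [Set.disjoint_left]
  rintro e ⟨hm, j, hj, he⟩ he'
  have := mem_edgesIn.1 he'
  have h1 : e ⊆ t ∩ (A ∪ Finset.Iic w) := Finset.subset_inter this.1 fun x hx => by
    have := he hx
    simp only [Finset.mem_insert, Finset.mem_union, Finset.mem_Iic] at this ⊢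
    rcases this with rfl | rfl | h
    · exact Or.inr hj
    · exact Or.inr le_rfl
    · exact Or.inl h
  have h2 := Finset.card_le_card h1
  omega

theorem cov_present_edgesIn_eq_zero (p : ℕ → I) (m : ℕ) {t t' : Finset (Fin n)}
    (h : (t ∩ t').card < m) :
    cov[present (edgesIn m t), present (edgesIn m t'); hypergraphLaw p n] = 0 := by
  refine cov_eq_zero_of_dependsOn p (dependsOn_present _) (dependsOn_present _) ?_
  rw [Finset.disjoint_coe, Finset.disjoint_iff_inter_eq_empty, edgesIn_inter,
    Finset.eq_empty_iff_forall_notMem]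
  intro e he
  have := mem_edgesIn.1 he
  have := Finset.card_le_card this.1
  omega

theorem cov_present_edgesIn_eq (p : ℕ → I) (k' : ℕ) (hc : (p (k' + 1) : ℝ) ≠ 0)
    {t t' : Finset (Fin n)} (h : (t ∩ t').card = k' + 2) :
    cov[present (edgesIn (k' + 2) t), present (edgesIn (k' + 2) t'); hypergraphLaw p n] =
      faceProb p k' t.card * faceProb p k' t'.card * ((p (k' + 1) : ℝ)⁻¹ - 1) := by
  have hI : ∏ e ∈ edgesIn (k' + 2) t ∩ edgesIn (k' + 2) t', (p (e.card - 1) : ℝ) =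
      p (k' + 1) := by
    rw [edgesIn_inter, prod_edgesIn, h]
    simp [faceProb]
  rw [cov_eq_sub_of_finite, integral_present_mul p (by rwa [hI]), hI, integral_present,
    integral_present, prod_edgesIn, prod_edgesIn]
  field_simp

/-! ### Critical simplices in terms of simplices without candidates -/

/-- The number of `(α + 1)`-element simplices to which no smaller vertex can be added, where only
hyperedges with at least `m` vertices are taken into account. -/
def unmatchedCount (m α : ℕ) (H : Finset (Fin n) → Bool) : ℝ :=
  ∑ w : Fin n, ∑ A ∈ (Finset.Ioi w).powersetCard α, unmatched m w A H

/-- The number of `b`-element simplices, where only hyperedges with at least `m` vertices are taken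
into account. -/
def faceCount (m b : ℕ) (H : Finset (Fin n) → Bool) : ℝ :=
  ∑ t ∈ Finset.univ.powersetCard b, present (edgesIn m t) H

theorem sum_powersetCard_succ (α : ℕ) (g : Finset (Fin n) → ℝ) :
    ∑ t ∈ Finset.univ.powersetCard (α + 1), g t =
      ∑ w : Fin n, ∑ A ∈ (Finset.Ioi w).powersetCard α, g (insert w A) := by
  rw [Finset.sum_sigma']
  symm
  refine Finset.sum_bij (fun q _ => insert q.1 q.2) ?_ ?_ ?_ fun _ _ => rfl
  · rintro ⟨w, A⟩ hq
    simp only [Finset.mem_sigma, Finset.mem_univ, Finset.mem_powersetCard, true_and] at hq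
    have hw : w ∉ A := fun h => lt_irrefl _ (Finset.mem_Ioi.1 (hq.1 h))
    simp [Finset.mem_powersetCard, Finset.card_insert_of_notMem hw, hq.2]
  · rintro ⟨w, A⟩ hq ⟨w', A'⟩ hq' h
    simp only [Finset.mem_sigma, Finset.mem_univ, Finset.mem_powersetCard, true_and] at hq hq' h
    have hw : w ∉ A := fun h => lt_irrefl _ (Finset.mem_Ioi.1 (hq.1 h))
    have hw' : w' ∉ A' := fun h => lt_irrefl _ (Finset.mem_Ioi.1 (hq'.1 h))
    have h1 : w = w' := le_antisymm
      (le_of_mem_insert hq.1 (h ▸ Finset.mem_insert_self _ _))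
      (le_of_mem_insert hq'.1 (h ▸ Finset.mem_insert_self _ _))
    subst h1
    rw [← Finset.erase_insert hw, ← Finset.erase_insert hw', h]
  · intro t ht
    have htc := (Finset.mem_powersetCard.1 ht).2
    have hne : t.Nonempty := Finset.card_pos.1 (by omega)
    refine ⟨⟨t.min' hne, t.erase (t.min' hne)⟩, ?_, Finset.insert_erase (t.min'_mem hne)⟩
    simp only [Finset.mem_sigma, Finset.mem_univ, Finset.mem_powersetCard, true_and]
    refine ⟨fun x hx => Finset.mem_Ioi.2 ?_, ?_⟩
    · have := Finset.mem_erase.1 hx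
      exact lt_of_le_of_ne (t.min'_le x this.2) this.1.symm
    · rw [Finset.card_erase_of_mem (t.min'_mem hne), htc, Nat.add_sub_cancel]

theorem mem_largestComplex {H : Finset (Fin n) → Bool} {s : Finset (Fin n)} :
    s ∈ largestComplex H ↔ s.Nonempty ∧ ∀ t ⊆ s, 2 ≤ t.card → H t = true := Iff.rfl

theorem mem_largestComplex_of_subset {H : Finset (Fin n) → Bool} {s t : Finset (Fin n)}
    (ht : t ∈ largestComplex H) (hst : s ⊆ t) (hs : s.Nonempty) : s ∈ largestComplex H :=
  ⟨hs, fun u hu => (mem_largestComplex.1 ht).2 u (hu.trans hst)⟩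

theorem insert_mem_largestComplex_iff {H : Finset (Fin n) → Bool} {s : Finset (Fin n)} {j : Fin n}
    (hs : s ∈ largestComplex H) (hj : j ∉ s) :
    insert j s ∈ largestComplex H ↔ ∀ e ∈ cone 2 j s, H e = true := by
  rw [mem_largestComplex]
  constructor
  · intro h e he
    rw [mem_cone hj] at he
    exact h.2 e he.2.1 he.2.2
  · intro h
    refine ⟨Finset.insert_nonempty _ _, fun e he h2 => ?_⟩
    by_cases hje : j ∈ e
    · exact h e ((mem_cone hj).2 ⟨hje, he, h2⟩)
    · exact (mem_largestComplex.1 hs).2 e ((Finset.subset_insert_iff_of_notMem hje).1 he) h2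

open Classical in
theorem present_edgesIn_two (H : Finset (Fin n) → Bool) {t : Finset (Fin n)} (ht : t.Nonempty) :
    present (edgesIn 2 t) H = if t ∈ largestComplex H then 1 else 0 := by
  rw [present_eq_ite]
  refine if_congr ?_ rfl rfl
  simp [mem_largestComplex, mem_edgesIn, ht]

open Classical in
theorem unmatched_two (H : Finset (Fin n) → Bool) {w : Fin n} {A : Finset (Fin n)}
    (hA : A ⊆ Finset.Ioi w) :
    unmatched 2 w A H = if insert w A ∈ largestComplex H ∧
      lexCandidates (largestComplex H) (insert w A) = ∅ then 1 else 0 := by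
  rw [unmatched, present_edgesIn_two H (Finset.insert_nonempty _ _)]
  by_cases ht : insert w A ∈ largestComplex H
  · simp only [ht, if_true, one_mul, true_and]
    have h1 : ∀ j ∈ Finset.Iio w, 1 - present (cone 2 j (insert w A)) H =
        if j ∉ lexCandidates (largestComplex H) (insert w A) then 1 else 0 := by
      intro j hj
      have hj' := Finset.mem_Iio.1 hj
      have : j ∈ lexCandidates (largestComplex H) (insert w A) ↔
          ∀ e ∈ cone 2 j (insert w A), H e = true := by
        rw [← insert_mem_largestComplex_iff ht (notMem_insert_of_lt hA hj')]
        exact and_iff_right fun v hv => hj'.trans_le (le_of_mem_insert hA hv)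
      rw [present_eq_ite]
      split_ifs <;> simp_all
    rw [Finset.prod_congr rfl h1]
    refine Finset.prod_boole.trans ?_
    have h2 : (∀ j ∈ Finset.Iio w, j ∉ lexCandidates (largestComplex H) (insert w A)) ↔
        lexCandidates (largestComplex H) (insert w A) = ∅ := by
      rw [Set.eq_empty_iff_forall_notMem]
      exact ⟨fun h j hj => h j (Finset.mem_Iio.2 (hj.1 w (Finset.mem_insert_self _ _))) hj,
        fun h j _ => h j⟩
    by_cases h : lexCandidates (largestComplex H) (insert w A) = ∅
    · rw [if_pos h, if_pos (h2.2 h)]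
    · rw [if_neg h, if_neg (mt h2.1 h)]
  · simp [ht]

open Classical in
theorem unmatchedCount_two (α : ℕ) (H : Finset (Fin n) → Bool) :
    unmatchedCount 2 α H = ((Finset.univ.filter fun t : Finset (Fin n) => t.card = α + 1 ∧
      t ∈ largestComplex H ∧ lexCandidates (largestComplex H) t = ∅).card : ℝ) := by
  rw [Finset.card_filter]
  push_cast
  have h := sum_powersetCard_succ α fun t : Finset (Fin n) => if t ∈ largestComplex H ∧
    lexCandidates (largestComplex H) t = ∅ then (1 : ℝ) else 0
  rw [← Finset.univ_filter_card_eq, Finset.sum_filter] at h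
  simp only [ite_and] at h ⊢
  rw [h]
  refine Finset.sum_congr rfl fun w _ => Finset.sum_congr rfl fun A hA => ?_
  rw [unmatched_two H (Finset.mem_powersetCard.1 hA).1, ite_and]

open Classical in
theorem faceCount_two {b : ℕ} (hb : b ≠ 0) (H : Finset (Fin n) → Bool) :
    faceCount 2 b H = ((Finset.univ.filter fun t : Finset (Fin n) => t.card = b ∧
      t ∈ largestComplex H).card : ℝ) := by
  rw [Finset.card_filter]
  push_cast
  simp only [ite_and]
  rw [← Finset.sum_filter, Finset.univ_filter_card_eq]
  refine Finset.sum_congr rfl fun t ht => present_edgesIn_two H (Finset.card_pos.1 ?_)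
  rw [(Finset.mem_powersetCard.1 ht).2]
  omega

theorem exists_isLeast_lexCandidates (L : AbstractSimplicialComplex (Fin n)) (s : Finset (Fin n))
    (h : (lexCandidates L s).Nonempty) : ∃ i, IsLeast (lexCandidates L s) i := by
  obtain ⟨i, hi⟩ := (Set.toFinite (lexCandidates L s)).exists_minimal h
  exact ⟨i, hi.1, fun j hj => not_lt.1 fun hlt => absurd (hi.2 hj hlt.le) (not_le.2 hlt)⟩

/-- A candidate j for s ∪ {i} would also be a candidate for s, and j < i contradicts minimality. -/
theorem lexCandidates_insert_eq_empty {H : Finset (Fin n) → Bool} {s : Finset (Fin n)} {i : Fin n}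
    (h : IsLeast (lexCandidates (largestComplex H) s) i) :
    lexCandidates (largestComplex H) (insert i s) = ∅ := by
  rw [Set.eq_empty_iff_forall_notMem]
  rintro j ⟨hj, hjL⟩
  have hji : j < i := hj i (Finset.mem_insert_self _ _)
  refine absurd (h.2 ⟨fun v hv => hj v (Finset.mem_insert_of_mem hv), ?_⟩) (not_le.2 hji)
  exact mem_largestComplex_of_subset hjL
    (Finset.insert_subset_insert _ (Finset.subset_insert _ _)) (Finset.insert_nonempty _ _)

theorem isCritical_iff (H : Finset (Fin n) → Bool) (t : Finset (Fin n)) :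
    IsCritical (largestComplex H) (lexMatching (largestComplex H)) t ↔
      (t ∈ largestComplex H ∧ lexCandidates (largestComplex H) t = ∅) ∧
        ¬ ∃ s, (s, t) ∈ lexMatching (largestComplex H) := by
  constructor
  · rintro ⟨htL, ht⟩
    refine ⟨⟨htL, ?_⟩, ?_⟩
    · by_contra hne
      obtain ⟨i, hi⟩ := exists_isLeast_lexCandidates _ t (Set.nonempty_iff_ne_empty.2 hne)
      exact (ht (t, insert i t) ⟨htL, i, hi, rfl⟩).1 rfl
    · rintro ⟨s, hs⟩
      exact (ht (s, t) hs).2 rfl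
  · rintro ⟨⟨htL, ht⟩, hs⟩
    refine ⟨htL, ?_⟩
    rintro ⟨s, u⟩ hq
    refine ⟨?_, ?_⟩
    · rintro rfl
      obtain ⟨-, i, hi, -⟩ := hq
      have : i ∈ (∅ : Set (Fin n)) := ht ▸ hi.1
      exact this
    · rintro rfl
      exact hs ⟨s, hq⟩

/-- Critical simplices are those without candidates that are not upper partners. The set D of upper
partners is in bijection, via s ↦ s ∪ {min I(s)}, with the simplices one dimension lower that have a
candidate. -/
theorem critCount_eq (α : ℕ) (H : Finset (Fin n) → Bool) :
    critCount (α + 2) H =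
      unmatchedCount 2 (α + 1) H + unmatchedCount 2 α H - faceCount 2 (α + 1) H := by
  classical
  set L := largestComplex H with hL
  set U : ℕ → Finset (Finset (Fin n)) := fun a =>
    Finset.univ.filter fun t => t.card = a ∧ t ∈ L ∧ lexCandidates L t = ∅ with hU
  set D : Finset (Finset (Fin n)) :=
    Finset.univ.filter fun t => t.card = α + 2 ∧ ∃ s, (s, t) ∈ lexMatching L with hD
  set F : Finset (Finset (Fin n)) := Finset.univ.filter fun t => t.card = α + 1 ∧ t ∈ L with hF
  have hDU : D ⊆ U (α + 2) := by
    intro t ht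
    simp only [hD, hU, Finset.mem_filter, Finset.mem_univ, true_and] at ht ⊢
    obtain ⟨hc, s, hsL, i, hi, hts⟩ := ht
    dsimp only at hsL hi hts
    subst hts
    exact ⟨hc, hi.1.2, lexCandidates_insert_eq_empty hi⟩
  have hUF : U (α + 1) ⊆ F := by
    intro t ht
    simp only [hU, hF, Finset.mem_filter, Finset.mem_univ, true_and] at ht ⊢
    exact ⟨ht.1, ht.2.1⟩
  have hcrit : (Finset.univ.filter fun t : Finset (Fin n) =>
      t.card = α + 2 ∧ IsCritical L (lexMatching L) t) = U (α + 2) \ D := by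
    ext t
    simp only [hU, hD, hL, Finset.mem_filter, Finset.mem_univ, true_and, Finset.mem_sdiff,
      isCritical_iff]
    tauto
  have hcard : (F \ U (α + 1)).card = D.card := by
    have hF' : ∀ s ∈ F \ U (α + 1), s.card = α + 1 ∧ s ∈ L ∧
        ∃ i, IsLeast (lexCandidates L s) i := by
      intro s hs
      simp only [hF, hU, Finset.mem_sdiff, Finset.mem_filter, Finset.mem_univ, true_and] at hs
      refine ⟨hs.1.1, hs.1.2, exists_isLeast_lexCandidates _ _ (Set.nonempty_iff_ne_empty.2 ?_)⟩
      tauto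
    have hnot : ∀ {s : Finset (Fin n)} {i}, IsLeast (lexCandidates L s) i → i ∉ s :=
      fun hi h => lt_irrefl _ (hi.1.1 _ h)
    refine Finset.card_bij (fun s hs => insert (hF' s hs).2.2.choose s) ?_ ?_ ?_
    · intro s hs
      obtain ⟨h1, h2, h3⟩ := hF' s hs
      simp only [hD, Finset.mem_filter, Finset.mem_univ, true_and]
      refine ⟨?_, s, h2, _, (hF' s hs).2.2.choose_spec, rfl⟩
      rw [Finset.card_insert_of_notMem (hnot (hF' s hs).2.2.choose_spec), h1]
    · intro s hs s' hs' h
      have hi := (hF' s hs).2.2.choose_spec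
      have hi' := (hF' s' hs').2.2.choose_spec
      set i := (hF' s hs).2.2.choose
      set i' := (hF' s' hs').2.2.choose
      -- The added vertex is the minimum of the enlarged simplex, so it, and then s, can be
      -- recovered.
      have hle : ∀ {s s' : Finset (Fin n)} {i i'}, IsLeast (lexCandidates L s) i →
          insert i s = insert i' s' → i ≤ i' := by
        intro s s' i i' hi h
        have h1 : i' ∈ insert i s := h ▸ Finset.mem_insert_self _ _
        rcases Finset.mem_insert.1 h1 with h2 | h2
        · exact h2.ge
        · exact (hi.1.1 _ h2).le
      have hii : i = i' := le_antisymm (hle hi h) (hle hi' h.symm)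
      rw [← Finset.erase_insert (hnot hi), ← Finset.erase_insert (hnot hi'), h, hii]
    · intro t ht
      simp only [hD, Finset.mem_filter, Finset.mem_univ, true_and] at ht
      obtain ⟨hc, s, hsL, i, hi, hts⟩ := ht
      dsimp only at hsL hi hts
      subst hts
      have hsc : s.card = α + 1 := by
        rw [Finset.card_insert_of_notMem (hnot hi)] at hc
        omega
      have hs : s ∈ F \ U (α + 1) := by
        simp only [hF, hU, Finset.mem_sdiff, Finset.mem_filter, Finset.mem_univ, true_and]
        refine ⟨⟨hsc, hsL⟩, fun h => ?_⟩
        exact (Set.nonempty_iff_ne_empty.1 ⟨i, hi.1⟩) h.2.2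
      exact ⟨s, hs, by rw [((hF' s hs).2.2.choose_spec).unique hi]⟩
  rw [unmatchedCount_two, unmatchedCount_two, faceCount_two (by omega)]
  have h1 := Finset.card_sdiff_add_card_eq_card hDU
  have h2 := Finset.card_sdiff_add_card_eq_card hUF
  have h3 : critCount (α + 2) H = ((U (α + 2) \ D).card : ℝ) := by
    rw [← hcrit]
    rfl
  rw [h3]
  have h4 : ((U (α + 2) \ D).card : ℝ) + F.card = (U (α + 2)).card + (U (α + 1)).card := by
    exact_mod_cast (by omega : (U (α + 2) \ D).card + F.card = _)
  linarith

/-! ### Discarding the hyperedges that are almost surely present -/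

theorem ae_present_edgesIn_eq (p : ℕ → I) {k' : ℕ} (hone : ∀ l, 1 ≤ l → l ≤ k' → p l = 1) :
    ∀ᵐ H ∂hypergraphLaw p n, ∀ e : Finset (Fin n), 2 ≤ e.card → e.card < k' + 2 → H e = true := by
  refine ae_all_iff.2 fun e => ?_
  by_cases he : 2 ≤ e.card ∧ e.card < k' + 2
  · filter_upwards [ae_eq_true p e (hone _ (by omega) (by omega))] with H hH _ _ using hH
  · exact .of_forall fun H h1 h2 => absurd ⟨h1, h2⟩ he

theorem present_edgesIn_eq_of_small {k' : ℕ} {H : Finset (Fin n) → Bool}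
    (hH : ∀ e : Finset (Fin n), 2 ≤ e.card → e.card < k' + 2 → H e = true) (t : Finset (Fin n)) :
    present (edgesIn 2 t) H = present (edgesIn (k' + 2) t) H := by
  rw [present_eq_ite, present_eq_ite]
  refine if_congr ⟨fun h e he => ?_, fun h e he => ?_⟩ rfl rfl
  · rw [mem_edgesIn] at he
    exact h e (mem_edgesIn.2 ⟨he.1, by omega⟩)
  · rw [mem_edgesIn] at he
    by_cases h2 : e.card < k' + 2
    · exact hH e he.2 h2
    · exact h e (mem_edgesIn.2 ⟨he.1, by omega⟩)

theorem present_cone_eq_of_small {k' : ℕ} {H : Finset (Fin n) → Bool}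
    (hH : ∀ e : Finset (Fin n), 2 ≤ e.card → e.card < k' + 2 → H e = true) {t : Finset (Fin n)}
    {j : Fin n} (hj : j ∉ t) :
    present (cone 2 j t) H = present (cone (k' + 2) j t) H := by
  rw [present_eq_ite, present_eq_ite]
  refine if_congr ⟨fun h e he => ?_, fun h e he => ?_⟩ rfl rfl
  · rw [mem_cone hj] at he
    exact h e ((mem_cone hj).2 ⟨he.1, he.2.1, by omega⟩)
  · rw [mem_cone hj] at he
    by_cases h2 : e.card < k' + 2
    · exact hH e he.2.2 h2
    · exact h e ((mem_cone hj).2 ⟨he.1, he.2.1, by omega⟩)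

theorem unmatchedCount_eq_of_small {k' : ℕ} {H : Finset (Fin n) → Bool}
    (hH : ∀ e : Finset (Fin n), 2 ≤ e.card → e.card < k' + 2 → H e = true) (α : ℕ) :
    unmatchedCount 2 α H = unmatchedCount (k' + 2) α H := by
  refine Finset.sum_congr rfl fun w _ => Finset.sum_congr rfl fun A hA => ?_
  have hA' := (Finset.mem_powersetCard.1 hA).1
  rw [unmatched, unmatched, present_edgesIn_eq_of_small hH]
  congr 1
  exact Finset.prod_congr rfl fun j hj => by
    rw [present_cone_eq_of_small hH (notMem_insert_of_lt hA' (Finset.mem_Iio.1 hj))]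

/-- The bracketing isolates the leading term from a remainder of smaller variance. -/
theorem ae_critCount_eq (p : ℕ → I) {k' : ℕ} (hone : ∀ l, 1 ≤ l → l ≤ k' → p l = 1) (α : ℕ) :
    critCount (α + 2) =ᵐ[hypergraphLaw p n] fun H => unmatchedCount (k' + 2) (α + 1) H +
      (unmatchedCount (k' + 2) α H - faceCount (k' + 2) (α + 1) H) := by
  filter_upwards [ae_present_edgesIn_eq p hone] with H hH
  rw [critCount_eq, unmatchedCount_eq_of_small hH, unmatchedCount_eq_of_small hH, faceCount,
    faceCount, Finset.sum_congr rfl fun t _ => present_edgesIn_eq_of_small hH t]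
  ring

/-! ### Bounds for the parameters -/

theorem rho_nonneg (p : ℕ → I) (k' a : ℕ) : 0 ≤ rho p k' a :=
  Finset.prod_nonneg fun i _ => pow_nonneg (p i).2.1 _

theorem faceProb_le_one (p : ℕ → I) (k' a : ℕ) : faceProb p k' a ≤ 1 :=
  Finset.prod_le_one (fun i _ => pow_nonneg (p (i - 1)).2.1 _)
    fun i _ => pow_le_one₀ (p (i - 1)).2.1 (p (i - 1)).2.2

theorem rho_le (p : ℕ → I) {k' a : ℕ} (ha : k' + 1 ≤ a) : rho p k' a ≤ p (k' + 1) := by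
  unfold rho
  rw [← Finset.mul_prod_erase _ _ (Finset.left_mem_Icc.2 ha)]
  have h1 : (p (k' + 1) : ℝ) ^ a.choose (k' + 1) ≤ p (k' + 1) :=
    pow_le_of_le_one (p (k' + 1)).2.1 (p (k' + 1)).2.2 (Nat.choose_pos ha).ne'
  refine (mul_le_of_le_one_right (pow_nonneg (p (k' + 1)).2.1 _) ?_).trans h1
  exact Finset.prod_le_one (fun i _ => pow_nonneg (p i).2.1 _)
    fun i _ => pow_le_one₀ (p i).2.1 (p i).2.2

theorem rho_pos (p : ℕ → I) {k' a : ℕ} (h : ∀ l, k' < l → l ≤ a → p l ≠ 0) :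
    0 < rho p k' a := by
  refine Finset.prod_pos fun i hi => pow_pos ?_ _
  have hi' := Finset.mem_Icc.1 hi
  exact unitInterval.pos_iff_ne_zero.2 (h i (by omega) hi'.2)

theorem faceProb_pos (p : ℕ → I) {k' a : ℕ} (h : ∀ l, k' < l → l < a → p l ≠ 0) :
    0 < faceProb p k' a := by
  refine Finset.prod_pos fun i hi => pow_pos ?_ _
  have hi' := Finset.mem_Icc.1 hi
  exact unitInterval.pos_iff_ne_zero.2 (h (i - 1) (by omega) (by omega))

/-! ### Covariances of the numbers of simplices without candidates -/

theorem integral_unmatched_le (p : ℕ → I) (k' : ℕ) {w : Fin n} {A : Finset (Fin n)}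
    (hA : A ⊆ Finset.Ioi w) (hρ : rho p k' (A.card + 1) ≤ 1) :
    ∫ H, unmatched (k' + 2) w A H ∂hypergraphLaw p n ≤
      (1 - rho p k' (A.card + 1)) ^ (w : ℕ) := by
  rw [integral_unmatched p k' hA]
  exact mul_le_of_le_one_left (pow_nonneg (by linarith) _) (faceProb_le_one p k' _)

/-- The covariance is bounded by either mean, hence by their geometric mean. This gives decay in w
and w' jointly, as summation over both requires. -/
theorem abs_cov_unmatched_le (p : ℕ → I) (k' : ℕ) {s : ℝ} (hs : 0 ≤ s) {w w' : Fin n}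
    {A B : Finset (Fin n)} (hA : A ⊆ Finset.Ioi w) (hB : B ⊆ Finset.Ioi w')
    (hsA : 1 - rho p k' (A.card + 1) ≤ s ^ 2) (hsB : 1 - rho p k' (B.card + 1) ≤ s ^ 2)
    (hρA : rho p k' (A.card + 1) ≤ 1) (hρB : rho p k' (B.card + 1) ≤ 1) :
    |cov[unmatched (k' + 2) w A, unmatched (k' + 2) w' B; hypergraphLaw p n]| ≤
      s ^ (w : ℕ) * s ^ (w' : ℕ) := by
  have h1 := abs_cov_le_integral (hypergraphLaw p n) (unmatched_nonneg (k' + 2) w A)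
    (unmatched_nonneg (k' + 2) w' B) (unmatched_le_one (k' + 2) w' B)
  have h2 := abs_cov_le_integral (hypergraphLaw p n) (unmatched_nonneg (k' + 2) w' B)
    (unmatched_nonneg (k' + 2) w A) (unmatched_le_one (k' + 2) w A)
  rw [covariance_comm] at h2
  have h3 := (h1.trans (integral_unmatched_le p k' hA hρA)).trans
    (pow_le_pow_left₀ (by linarith) hsA _)
  have h4 := (h2.trans (integral_unmatched_le p k' hB hρB)).trans
    (pow_le_pow_left₀ (by linarith) hsB _)
  refine abs_le_of_sq_le_sq ?_ (by positivity)
  rw [← sq_abs]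
  calc |cov[unmatched (k' + 2) w A, unmatched (k' + 2) w' B; hypergraphLaw p n]| ^ 2
      ≤ (s ^ 2) ^ (w : ℕ) * (s ^ 2) ^ (w' : ℕ) := by
        rw [sq]
        exact mul_le_mul h3 h4 (abs_nonneg _) (by positivity)
    _ = _ := by ring

/-- The contribution to the covariance of the simplices with smallest vertices `w` and `w'`. -/
def covBlock (p : ℕ → I) (k' α β n w w' : ℕ) : ℝ :=
  if h : w < n ∧ w' < n then
    ∑ A ∈ (Finset.Ioi (⟨w, h.1⟩ : Fin n)).powersetCard α,
      ∑ B ∈ (Finset.Ioi (⟨w', h.2⟩ : Fin n)).powersetCard β,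
        cov[unmatched (k' + 2) ⟨w, h.1⟩ A, unmatched (k' + 2) ⟨w', h.2⟩ B; hypergraphLaw p n]
  else 0

/-- Since `covBlock` is 0 out of range, the index set becomes independent of n, as dominated
convergence requires. -/
theorem cov_unmatchedCount_eq_tsum (p : ℕ → I) (k' α β n : ℕ) :
    cov[unmatchedCount (k' + 2) α, unmatchedCount (k' + 2) β; hypergraphLaw p n] =
      ∑' q : ℕ × ℕ, covBlock p k' α β n q.1 q.2 := by
  rw [tsum_eq_sum (s := Finset.range n ×ˢ Finset.range n), Finset.sum_product,
    ← Fin.sum_univ_eq_sum_range (fun w => ∑ w' ∈ Finset.range n, covBlock p k' α β n w w')]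
  · unfold unmatchedCount
    rw [covariance_fun_sum_fun_sum (fun _ => .of_discrete) (fun _ => .of_discrete)]
    refine Finset.sum_congr rfl fun w _ => ?_
    rw [← Fin.sum_univ_eq_sum_range (fun w' => covBlock p k' α β n w w')]
    refine Finset.sum_congr rfl fun w' _ => ?_
    rw [covariance_fun_sum_fun_sum' (fun _ _ => .of_discrete) (fun _ _ => .of_discrete), covBlock,
      dif_pos ⟨w.2, w'.2⟩]
  · intro q hq
    rw [covBlock, dif_neg]
    simpa using hq

theorem covBlock_comm (p : ℕ → I) (k' α β n w w' : ℕ) :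
    covBlock p k' α β n w w' = covBlock p k' β α n w' w := by
  unfold covBlock
  by_cases h : w < n ∧ w' < n
  · rw [dif_pos h, dif_pos h.symm, Finset.sum_comm]
    exact Finset.sum_congr rfl fun _ _ => Finset.sum_congr rfl fun _ _ => covariance_comm _ _
  · rw [dif_neg h, dif_neg (mt And.symm h)]

theorem abs_covBlock_self_mul_le (p : ℕ → I) {k' α β : ℕ} {s : ℝ} (hs : 0 ≤ s)
    (hsα : 1 - rho p k' (α + 1) ≤ s ^ 2) (hsβ : 1 - rho p k' (β + 1) ≤ s ^ 2)
    (hρα : rho p k' (α + 1) ≤ 1) (hρβ : rho p k' (β + 1) ≤ 1) (n w : ℕ) :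
    |covBlock p k' α β n w w| * n ^ k' ≤ s ^ w * s ^ w * α.choose k' * n ^ (α + β) := by
  unfold covBlock
  split_ifs with h
  · refine sum_powersetCard_le_card_inter_mul_pow_le _ _ α β k' id
      (fun A hA => (Finset.mem_powersetCard.1 hA).2.le) (by positivity) ?_ ?_
    · intro A hA B hB hAB
      rw [id, Finset.inter_comm] at hAB
      exact cov_unmatched_eq_zero_of_card_inter_lt p k' (Finset.mem_powersetCard.1 hA).1
        (Finset.mem_powersetCard.1 hB).1 hAB
    · intro A hA B hB
      obtain ⟨hA1, rfl⟩ := Finset.mem_powersetCard.1 hA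
      obtain ⟨hB1, rfl⟩ := Finset.mem_powersetCard.1 hB
      exact abs_cov_unmatched_le p k' hs hA1 hB1 hsα hsβ hρα hρβ
  · rw [abs_zero, zero_mul]
    positivity

theorem abs_covBlock_mul_le_of_lt (p : ℕ → I) {k' α β : ℕ} {s : ℝ} (hs : 0 ≤ s)
    (hsα : 1 - rho p k' (α + 1) ≤ s ^ 2) (hsβ : 1 - rho p k' (β + 1) ≤ s ^ 2)
    (hρα : rho p k' (α + 1) ≤ 1) (hρβ : rho p k' (β + 1) ≤ 1) (n : ℕ) {w w' : ℕ} (hw : w < w') :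
    |covBlock p k' α β n w w'| * n ^ (k' + 1) ≤
      s ^ w * s ^ w' * (β + 1).choose (k' + 1) * n ^ (α + β) := by
  unfold covBlock
  split_ifs with h
  -- The overlap condition concerns {w'} ∪ B, so B has to be the outer variable.
  · rw [Finset.sum_comm, add_comm α β]
    refine sum_powersetCard_le_card_inter_mul_pow_le _ _ β α (k' + 1) (insert ⟨w', h.2⟩)
      (fun B hB => (Finset.card_insert_le _ _).trans
        (Nat.add_le_add_right (Finset.mem_powersetCard.1 hB).2.le 1)) (by positivity) ?_ ?_
    · intro B hB A hA hAB
      exact cov_unmatched_eq_zero_of_lt p k' (Fin.mk_lt_mk.2 hw) (Finset.mem_powersetCard.1 hA).1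
        (Finset.mem_powersetCard.1 hB).1 hAB
    · intro B hB A hA
      obtain ⟨hA1, rfl⟩ := Finset.mem_powersetCard.1 hA
      obtain ⟨hB1, rfl⟩ := Finset.mem_powersetCard.1 hB
      exact abs_cov_unmatched_le p k' hs hA1 hB1 hsα hsβ hρα hρβ
  · rw [abs_zero, zero_mul]
    positivity

theorem abs_covBlock_mul_le_of_ne (p : ℕ → I) {k' α β : ℕ} {s : ℝ} (hs : 0 ≤ s)
    (hsα : 1 - rho p k' (α + 1) ≤ s ^ 2) (hsβ : 1 - rho p k' (β + 1) ≤ s ^ 2)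
    (hρα : rho p k' (α + 1) ≤ 1) (hρβ : rho p k' (β + 1) ≤ 1) (n : ℕ) {w w' : ℕ} (hw : w ≠ w') :
    |covBlock p k' α β n w w'| * n ^ (k' + 1) ≤
      s ^ w * s ^ w' * (((α + 1).choose (k' + 1) : ℝ) + (β + 1).choose (k' + 1)) *
        n ^ (α + β) := by
  rcases lt_or_gt_of_ne hw with h | h
  · refine (abs_covBlock_mul_le_of_lt p hs hsα hsβ hρα hρβ n h).trans ?_
    gcongr
    linarith [Nat.cast_nonneg (α := ℝ) ((α + 1).choose (k' + 1))]
  · rw [covBlock_comm]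
    refine (abs_covBlock_mul_le_of_lt p hs hsβ hsα hρβ hρα n h).trans ?_
    rw [mul_comm (s ^ w'), add_comm β α]
    gcongr
    linarith [Nat.cast_nonneg (α := ℝ) ((β + 1).choose (k' + 1))]

theorem tendsto_card_Ioi_div (w : ℕ) :
    Tendsto (fun n : ℕ => ((Finset.univ.filter fun x : Fin n => w < (x : ℕ)).card : ℝ) / n) atTop
      (𝓝 1) := by
  have h : Tendsto (fun n : ℕ => ((id n : ℕ) : ℝ) / n) atTop (𝓝 1) := by
    refine tendsto_const_nhds.congr' ?_
    filter_upwards [eventually_gt_atTop 0] with n hn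
    have : (n : ℝ) ≠ 0 := by positivity
    simp [this]
  refine (tendsto_sub_const_div h (w + 1)).congr' ?_
  filter_upwards [eventually_gt_atTop w] with n hn
  have : (Finset.univ.filter fun x : Fin n => w < (x : ℕ)) = Finset.Ioi (⟨w, hn⟩ : Fin n) := by
    ext x
    simp [Fin.lt_def]
  rw [this, Fin.card_Ioi, id]
  congr 2
  simp only
  omega

theorem tendsto_covBlock_self (p : ℕ → I) {k' α β : ℕ} (hc : (p (k' + 1) : ℝ) ≠ 0)
    (hβ : k' ≤ β) (w : ℕ) :
    Tendsto (fun n : ℕ => covBlock p k' α β n w w * n ^ k' / n ^ (α + β)) atTop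
      (𝓝 (faceProb p k' (α + 1) * faceProb p k' (β + 1) *
        ((1 - rho p k' (α + 1) - rho p k' (β + 1) +
          rho p k' (α + 1) * rho p k' (β + 1) / rho p k' (k' + 1)) ^ w -
        ((1 - rho p k' (α + 1)) * (1 - rho p k' (β + 1))) ^ w) *
          (α.choose k' / (α.factorial * (β - k').factorial)))) := by
  have hV : ∀ n (hn : w < n), (Finset.univ.filter fun x : Fin n => w < (x : ℕ)) =
      Finset.Ioi (⟨w, hn⟩ : Fin n) := by
    intro n hn
    ext x
    simp [Fin.lt_def]
  refine (tendsto_pairSum (m := k') hβ _ (tendsto_card_Ioi_div w)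
    (c := fun n A B => if h : w < n then
      cov[unmatched (k' + 2) ⟨w, h⟩ A, unmatched (k' + 2) ⟨w, h⟩ B; hypergraphLaw p n] else 0)
    (M := 1) ?_ ?_ ?_).congr' ?_
  · filter_upwards [eventually_gt_atTop w] with n hn A hA B hB hAB
    rw [hV n hn] at hA hB
    rw [dif_pos hn]
    exact cov_unmatched_eq_zero_of_card_inter_lt p k' (Finset.mem_powersetCard.1 hA).1
        (Finset.mem_powersetCard.1 hB).1 hAB
  · filter_upwards [eventually_gt_atTop w] with n hn A hA B hB hAB
    rw [hV n hn] at hA hB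
    obtain ⟨hA1, hA2⟩ := Finset.mem_powersetCard.1 hA
    obtain ⟨hB1, hB2⟩ := Finset.mem_powersetCard.1 hB
    rw [dif_pos hn, cov_unmatched_eq p k' hc hA1 hB1 hAB, hA2, hB2]
  · filter_upwards [eventually_gt_atTop w] with n hn A hA B hB
    rw [dif_pos hn]
    refine (abs_cov_le_integral (hypergraphLaw p n) (unmatched_nonneg _ _ _)
      (unmatched_nonneg _ _ _) (unmatched_le_one _ _ _)).trans ?_
    calc _ ≤ ∫ _, (1 : ℝ) ∂hypergraphLaw p n :=
          integral_mono .of_finite .of_finite (unmatched_le_one _ _ _)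
      _ = 1 := by simp
  · filter_upwards [eventually_gt_atTop w] with n hn
    rw [covBlock, dif_pos ⟨hn, hn⟩, hV n hn]
    simp only [dif_pos hn]

theorem tendsto_covBlock_of_ne (p : ℕ → I) {k' α β : ℕ} (hρα : rho p k' (α + 1) ≤ 1)
    (hρβ : rho p k' (β + 1) ≤ 1) {w w' : ℕ} (hw : w ≠ w') :
    Tendsto (fun n : ℕ => covBlock p k' α β n w w' * n ^ k' / n ^ (α + β)) atTop (𝓝 0) := by
  have hz : Tendsto (fun n : ℕ => (((α + 1).choose (k' + 1) : ℝ) + (β + 1).choose (k' + 1)) / n)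
      atTop (𝓝 0) := tendsto_const_nhds.div_atTop tendsto_natCast_atTop_atTop
  refine squeeze_zero_norm' ?_ hz
  filter_upwards [eventually_gt_atTop 0] with n hn
  -- For fixed w and w' no decay is needed, so s = 1 suffices.
  have key := abs_covBlock_mul_le_of_ne p (s := 1) zero_le_one
    (by linarith [rho_nonneg p k' (α + 1)]) (by linarith [rho_nonneg p k' (β + 1)]) hρα hρβ n hw
  have hn' : (0 : ℝ) < n := by positivity
  rw [Real.norm_eq_abs, abs_div, abs_mul, abs_of_pos (a := (n : ℝ) ^ k') (by positivity),
    abs_of_pos (a := (n : ℝ) ^ (α + β)) (by positivity), div_le_div_iff₀ (by positivity) hn']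
  rw [pow_succ, one_pow, one_pow, one_mul, one_mul] at key
  linarith

/-- The limit of the normalized covariance of the numbers of simplices without candidates. -/
def covLimit (p : ℕ → I) (k' α β : ℕ) : ℝ :=
  faceProb p k' (α + 1) * faceProb p k' (β + 1) *
    ((rho p k' (α + 1) + rho p k' (β + 1) -
        rho p k' (α + 1) * rho p k' (β + 1) / rho p k' (k' + 1))⁻¹ -
      (rho p k' (α + 1) + rho p k' (β + 1) - rho p k' (α + 1) * rho p k' (β + 1))⁻¹) *
    (α.choose k' / (α.factorial * (β - k').factorial))

/-- Dominated convergence over pairs of minima, with dominating function C s^w s^w'. Only the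
diagonal survives, and its terms sum to two geometric series. -/
theorem tendsto_cov_unmatchedCount (p : ℕ → I) {k' α β : ℕ} (hc0 : 0 < (p (k' + 1) : ℝ))
    (hc1 : (p (k' + 1) : ℝ) < 1) (hα : k' ≤ α) (hβ : k' ≤ β) (hρα : 0 < rho p k' (α + 1))
    (hρβ : 0 < rho p k' (β + 1)) :
    Tendsto (fun n : ℕ => cov[unmatchedCount (k' + 2) α, unmatchedCount (k' + 2) β;
      hypergraphLaw p n] * n ^ k' / n ^ (α + β)) atTop (𝓝 (covLimit p k' α β)) := by
  have hα1 : rho p k' (α + 1) ≤ p (k' + 1) := rho_le p (by omega)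
  have hβ1 : rho p k' (β + 1) ≤ p (k' + 1) := rho_le p (by omega)
  have hρα' : rho p k' (α + 1) ≤ 1 := by linarith
  have hρβ' : rho p k' (β + 1) ≤ 1 := by linarith
  have hself := rho_self p k'
  set x := rho p k' (α + 1) with hx
  set y := rho p k' (β + 1) with hy
  set c : ℝ := ((p (k' + 1) : I) : ℝ) with hcdef
  -- The smaller of x and y gives the slower decay; the square root comes from the geometric-mean
  -- bound.
  set s : ℝ := Real.sqrt (1 - min x y) with hsdef
  have hmin : min x y ≤ 1 := (min_le_left _ _).trans hρα'
  have hs0 : 0 ≤ s := Real.sqrt_nonneg _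
  have hs2 : s ^ 2 = 1 - min x y := Real.sq_sqrt (by linarith)
  have hs1 : s < 1 := by
    have : 0 < min x y := lt_min hρα hρβ
    nlinarith
  have hsα : 1 - x ≤ s ^ 2 := by rw [hs2]; linarith [min_le_left x y]
  have hsβ : 1 - y ≤ s ^ 2 := by rw [hs2]; linarith [min_le_right x y]
  set C : ℝ := α.choose k' + (((α + 1).choose (k' + 1) : ℝ) + (β + 1).choose (k' + 1)) with hC
  have hgeo : Summable fun w : ℕ => s ^ w := summable_geometric_of_lt_one hs0 hs1
  have hbound : Summable fun q : ℕ × ℕ => C * (s ^ q.1 * s ^ q.2) :=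
    (hgeo.mul_of_nonneg hgeo (fun _ => by positivity) (fun _ => by positivity)).mul_left C
  set L : ℕ → ℝ := fun w => faceProb p k' (α + 1) * faceProb p k' (β + 1) *
        ((1 - x - y + x * y / rho p k' (k' + 1)) ^ w - ((1 - x) * (1 - y)) ^ w) *
          (α.choose k' / (α.factorial * (β - k').factorial)) with hL
  have hlim := tendsto_tsum_of_dominated_convergence (𝓕 := atTop)
    (f := fun (n : ℕ) (q : ℕ × ℕ) => covBlock p k' α β n q.1 q.2 * n ^ k' / n ^ (α + β))
    (g := fun q : ℕ × ℕ => if q.1 = q.2 then L q.1 else 0) hbound ?_ ?_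
  · have hsum : HasSum (fun q : ℕ × ℕ => if q.1 = q.2 then L q.1 else 0)
        (covLimit p k' α β) := by
      have hinj : Function.Injective fun w : ℕ => (w, w) := fun a b h => (Prod.mk.inj h).1
      refine (hinj.hasSum_iff ?_).1 ?_
      · rintro ⟨a, b⟩ hab
        refine if_neg ?_
        intro h
        exact hab ⟨a, Prod.ext rfl h⟩
      -- The numerator over c is (c - x)(c - y) + c(1 - c), a sum of nonnegative terms.
      · have hq0 : 0 ≤ 1 - x - y + x * y / c := by
          rw [show 1 - x - y + x * y / c = (c - x * c - y * c + x * y) / c by field_simp]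
          refine div_nonneg ?_ hc0.le
          nlinarith
        have hxy : 0 < x * y := mul_pos hρα hρβ
        have hq1 : 1 - x - y + x * y / c < 1 := by
          have : x * y / c ≤ x := by
            rw [div_le_iff₀ hc0]
            nlinarith
          linarith
        have hr0 : 0 ≤ (1 - x) * (1 - y) := mul_nonneg (by linarith) (by linarith)
        have hr1 : (1 - x) * (1 - y) < 1 := by nlinarith
        have h := (((hasSum_geometric_of_lt_one hq0 hq1).sub
          (hasSum_geometric_of_lt_one hr0 hr1)).mul_left
            (faceProb p k' (α + 1) * faceProb p k' (β + 1))).mul_right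
              ((α.choose k' : ℝ) / (α.factorial * (β - k').factorial))
        have hval : faceProb p k' (α + 1) * faceProb p k' (β + 1) *
            ((1 - (1 - x - y + x * y / c))⁻¹ - (1 - (1 - x) * (1 - y))⁻¹) *
            ((α.choose k' : ℝ) / (α.factorial * (β - k').factorial)) = covLimit p k' α β := by
          rw [covLimit, hself, ← hx, ← hy,
            show 1 - (1 - x - y + x * y / c) = x + y - x * y / c by ring,
            show 1 - (1 - x) * (1 - y) = x + y - x * y by ring]
        rw [hval] at h
        simpa only [Function.comp_def, if_true, hL, hself] using h
    rw [hsum.tsum_eq] at hlim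
    refine hlim.congr fun n => ?_
    rw [cov_unmatchedCount_eq_tsum, ← tsum_mul_right, ← tsum_div_const]
  · rintro ⟨w, w'⟩
    by_cases h : w = w'
    · subst h
      simpa only [if_true] using tendsto_covBlock_self p hc0.ne' hβ w
    · simpa only [h, if_false] using tendsto_covBlock_of_ne p hρα' hρβ' h
  · filter_upwards [eventually_ge_atTop 1] with n hn
    rintro ⟨w, w'⟩
    have hn' : (1 : ℝ) ≤ n := by exact_mod_cast hn
    have hn0 : (0 : ℝ) < n := by linarith
    simp only
    rw [Real.norm_eq_abs, abs_div, abs_mul, abs_of_pos (a := (n : ℝ) ^ k') (by positivity),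
      abs_of_pos (a := (n : ℝ) ^ (α + β)) (by positivity), div_le_iff₀ (by positivity)]
    by_cases h : w = w'
    · subst h
      refine (abs_covBlock_self_mul_le p hs0 hsα hsβ hρα' hρβ' n w).trans ?_
      rw [mul_comm (s ^ w * s ^ w)]
      gcongr
      rw [hC, le_add_iff_nonneg_right]
      positivity
    · have h1 := abs_covBlock_mul_le_of_ne p hs0 hsα hsβ hρα' hρβ' n h
      calc |covBlock p k' α β n w w'| * n ^ k'
          ≤ |covBlock p k' α β n w w'| * n ^ (k' + 1) := by
            gcongr
            omega
        _ ≤ _ := h1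
        _ ≤ _ := by
            rw [mul_comm (s ^ w * s ^ w')]
            gcongr
            rw [hC, le_add_iff_nonneg_left]
            positivity

/-! ### Face counts -/

theorem variance_faceCount_eq (p : ℕ → I) (m b n : ℕ) :
    variance (faceCount m b) (hypergraphLaw p n) =
      ∑ t ∈ (Finset.univ : Finset (Fin n)).powersetCard b,
        ∑ t' ∈ (Finset.univ : Finset (Fin n)).powersetCard b,
        cov[present (edgesIn m t), present (edgesIn m t'); hypergraphLaw p n] := by
  rw [← covariance_self (Measurable.of_discrete).aemeasurable]
  unfold faceCount
  rw [covariance_fun_sum_fun_sum' (fun _ _ => .of_discrete) (fun _ _ => .of_discrete)]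

theorem abs_cov_present_le_one (p : ℕ → I) (S T : Finset (Finset (Fin n))) :
    |cov[present S, present T; hypergraphLaw p n]| ≤ 1 := by
  refine (abs_cov_le_integral (hypergraphLaw p n) (present_nonneg _)
      (present_nonneg _) (present_le_one _)).trans ?_
  calc _ ≤ ∫ _, (1 : ℝ) ∂hypergraphLaw p n :=
        integral_mono .of_finite .of_finite (present_le_one _)
    _ = 1 := by simp

theorem variance_faceCount_mul_le (p : ℕ → I) (m b n : ℕ) :
    variance (faceCount m b) (hypergraphLaw p n) * n ^ m ≤ b.choose m * n ^ (b + b) := by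
  rw [← abs_of_nonneg (variance_nonneg (faceCount m b) (hypergraphLaw p n)),
    variance_faceCount_eq, ← one_mul (b.choose m : ℝ)]
  refine sum_powersetCard_le_card_inter_mul_pow_le _ _ b b m id
    (fun A hA => (Finset.mem_powersetCard.1 hA).2.le) zero_le_one ?_
    fun t _ t' _ => abs_cov_present_le_one p _ _
  intro t _ t' _ h
  rw [id, Finset.inter_comm] at h
  exact cov_present_edgesIn_eq_zero p m h

theorem tendsto_variance_faceCount (p : ℕ → I) {k' b : ℕ} (hc : (p (k' + 1) : ℝ) ≠ 0)
    (hb : k' + 2 ≤ b) :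
    Tendsto (fun n : ℕ => variance (faceCount (k' + 2) b) (hypergraphLaw p n) * n ^ (k' + 2) /
      n ^ (b + b)) atTop (𝓝 (faceProb p k' b * faceProb p k' b * ((p (k' + 1) : ℝ)⁻¹ - 1) *
        (b.choose (k' + 2) / (b.factorial * (b - (k' + 2)).factorial)))) := by
  simp only [variance_faceCount_eq]
  refine tendsto_pairSum (m := k' + 2) hb _ (V := fun n => Finset.univ) ?_ (M := 1) ?_ ?_ ?_
  · refine tendsto_const_nhds.congr' ?_
    filter_upwards [eventually_gt_atTop 0] with n hn
    have : (n : ℝ) ≠ 0 := by positivity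
    simp [this]
  · exact .of_forall fun n t _ t' _ h => cov_present_edgesIn_eq_zero p _ h
  · refine .of_forall fun n t ht t' ht' h => ?_
    rw [cov_present_edgesIn_eq p k' hc h, (Finset.mem_powersetCard.1 ht).2,
      (Finset.mem_powersetCard.1 ht').2]
  · exact .of_forall fun n t _ t' _ => abs_cov_present_le_one p _ _

theorem summable_choose_add_mul_geometric {r : ℝ} (hr0 : 0 ≤ r) (hr1 : r < 1) (d m : ℕ) :
    Summable fun w : ℕ => r ^ w * ((d + w + 1).choose m : ℝ) := by
  have h1 : Summable fun w : ℕ => ((d + 2 : ℕ) : ℝ) ^ m * ((w : ℝ) ^ m * r ^ w + r ^ w) :=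
    ((summable_pow_mul_geometric_of_norm_lt_one m
      (by rwa [Real.norm_of_nonneg hr0])).add (summable_geometric_of_lt_one hr0 hr1)).mul_left _
  refine h1.of_nonneg_of_le (fun w => by positivity) fun w => ?_
  have h2 : (d + w + 1).choose m ≤ (d + 2) ^ m * (w ^ m + 1) := by
    refine (Nat.choose_le_pow _ _).trans ?_
    rcases Nat.eq_zero_or_pos w with rfl | hw
    · calc (d + 0 + 1) ^ m ≤ (d + 2) ^ m := Nat.pow_le_pow_left (by omega) _
        _ ≤ (d + 2) ^ m * (0 ^ m + 1) := Nat.le_mul_of_pos_right _ (Nat.succ_pos _)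
    · calc (d + w + 1) ^ m ≤ ((d + 2) * w) ^ m := Nat.pow_le_pow_left (by nlinarith) _
        _ = (d + 2) ^ m * w ^ m := mul_pow _ _ _
        _ ≤ _ := Nat.mul_le_mul_left _ (by omega)
  have h3 : ((d + w + 1).choose m : ℝ) ≤ ((d + 2 : ℕ) : ℝ) ^ m * ((w : ℝ) ^ m + 1) := by
    exact_mod_cast h2
  calc r ^ w * ((d + w + 1).choose m : ℝ)
      ≤ r ^ w * (((d + 2 : ℕ) : ℝ) ^ m * ((w : ℝ) ^ m + 1)) := by gcongr
    _ = _ := by ring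

/-- Correlation requires t to meet A ∪ {0, …, w} in at least k'+2 points. This set has at most α+w+1
elements, so the count grows polynomially in w and is absorbed by the geometric decay. -/
theorem exists_abs_cov_unmatchedCount_faceCount_le (p : ℕ → I) {k' α : ℕ}
    (hρ0 : 0 < rho p k' (α + 1)) (hρ1 : rho p k' (α + 1) ≤ 1) (b : ℕ) :
    ∃ C : ℝ, ∀ n : ℕ, |cov[unmatchedCount (k' + 2) α, faceCount (k' + 2) b; hypergraphLaw p n]| *
      n ^ (k' + 2) ≤ C * n ^ (α + b) := by
  set r := 1 - rho p k' (α + 1) with hr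
  have hr0 : 0 ≤ r := by linarith
  have hsum := summable_choose_add_mul_geometric hr0 (by linarith) α (k' + 2)
  refine ⟨∑' w : ℕ, r ^ w * ((α + w + 1).choose (k' + 2) : ℝ), fun n => ?_⟩
  have hblock : ∀ w : Fin n, |∑ A ∈ (Finset.Ioi w).powersetCard α,
      ∑ t ∈ Finset.univ.powersetCard b,
        cov[unmatched (k' + 2) w A, present (edgesIn (k' + 2) t); hypergraphLaw p n]| *
          n ^ (k' + 2) ≤ r ^ (w : ℕ) * ((α + w + 1).choose (k' + 2) : ℕ) * n ^ (α + b) := by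
    intro w
    refine sum_powersetCard_le_card_inter_mul_pow_le _ _ α b (k' + 2)
      (fun A => A ∪ Finset.Iic w) ?_ (by positivity) ?_ ?_
    · intro A hA
      refine (Finset.card_union_le _ _).trans ?_
      rw [(Finset.mem_powersetCard.1 hA).2, Fin.card_Iic]
      omega
    · intro A hA t _ h
      exact cov_unmatched_present_eq_zero p _ (Finset.mem_powersetCard.1 hA).1 h
    · intro A hA t _
      obtain ⟨hA1, rfl⟩ := Finset.mem_powersetCard.1 hA
      exact (abs_cov_le_integral (hypergraphLaw p n) (unmatched_nonneg _ _ _)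
        (present_nonneg _) (present_le_one _)).trans (integral_unmatched_le p k' hA1 hρ1)
  have hcov : cov[unmatchedCount (k' + 2) α, faceCount (k' + 2) b; hypergraphLaw p n] =
      ∑ w : Fin n, ∑ A ∈ (Finset.Ioi w).powersetCard α, ∑ t ∈ Finset.univ.powersetCard b,
        cov[unmatched (k' + 2) w A, present (edgesIn (k' + 2) t); hypergraphLaw p n] := by
    unfold unmatchedCount faceCount
    rw [covariance_fun_sum_left (fun _ => .of_discrete) .of_discrete]
    refine Finset.sum_congr rfl fun w _ => ?_
    rw [covariance_fun_sum_fun_sum' (fun _ _ => .of_discrete) (fun _ _ => .of_discrete)]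
  rw [hcov]
  calc _ ≤ (∑ w : Fin n, |∑ A ∈ (Finset.Ioi w).powersetCard α, ∑ t ∈ Finset.univ.powersetCard b,
        cov[unmatched (k' + 2) w A, present (edgesIn (k' + 2) t); hypergraphLaw p n]|) *
          n ^ (k' + 2) := by
        gcongr
        exact Finset.abs_sum_le_sum_abs _ _
    _ ≤ ∑ w : Fin n, r ^ (w : ℕ) * ((α + w + 1).choose (k' + 2) : ℕ) * (n : ℝ) ^ (α + b) := by
        rw [Finset.sum_mul]
        exact Finset.sum_le_sum fun w _ => hblock w
    _ = (∑ w ∈ Finset.range n, r ^ w * ((α + w + 1).choose (k' + 2) : ℝ)) * (n : ℝ) ^ (α + b) := by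
        rw [← Finset.sum_mul, Fin.sum_univ_eq_sum_range
          (fun w => r ^ w * ((α + w + 1).choose (k' + 2) : ℝ))]
    _ ≤ _ := by
        gcongr
        exact hsum.sum_le_tsum _ fun w _ => by positivity

/-! ### Perturbation of normalized covariances -/

theorem tendsto_cov_mul_zero (p : ℕ → I) {X Y : ∀ n, (Finset (Fin n) → Bool) → ℝ} {f g : ℕ → ℝ}
    (hf : ∀ n, 0 ≤ f n) (hg : ∀ n, 0 ≤ g n) {v : ℝ}
    (hX : Tendsto (fun n => variance (X n) (hypergraphLaw p n) * (f n * f n)) atTop (𝓝 v))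
    (hY : Tendsto (fun n => variance (Y n) (hypergraphLaw p n) * (g n * g n)) atTop (𝓝 0)) :
    Tendsto (fun n => cov[X n, Y n; hypergraphLaw p n] * (f n * g n)) atTop (𝓝 0) := by
  have h := hX.sqrt.mul hY.sqrt
  rw [Real.sqrt_zero, mul_zero] at h
  refine squeeze_zero_norm (fun n => ?_) h
  rw [Real.norm_eq_abs, abs_mul, abs_of_nonneg (mul_nonneg (hf n) (hg n)),
    Real.sqrt_mul (variance_nonneg _ _), Real.sqrt_mul (variance_nonneg _ _),
    Real.sqrt_mul_self (hf n), Real.sqrt_mul_self (hg n)]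
  calc _ ≤ (Real.sqrt (variance (X n) (hypergraphLaw p n)) *
        Real.sqrt (variance (Y n) (hypergraphLaw p n))) * (f n * g n) :=
        mul_le_mul_of_nonneg_right (abs_cov_le_sqrt_mul_sqrt _ _ _)
          (mul_nonneg (hf n) (hg n))
    _ = _ := by ring

/-- By Cauchy–Schwarz, every cross term with a perturbation of vanishing normalized variance tends
to 0. -/
theorem tendsto_cov_add_add (p : ℕ → I) {X Y R Q : ∀ n, (Finset (Fin n) → Bool) → ℝ} {f g : ℕ → ℝ}
    (hf : ∀ n, 0 ≤ f n) (hg : ∀ n, 0 ≤ g n) {u v z : ℝ}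
    (hX : Tendsto (fun n => variance (X n) (hypergraphLaw p n) * (f n * f n)) atTop (𝓝 u))
    (hY : Tendsto (fun n => variance (Y n) (hypergraphLaw p n) * (g n * g n)) atTop (𝓝 v))
    (hR : Tendsto (fun n => variance (R n) (hypergraphLaw p n) * (f n * f n)) atTop (𝓝 0))
    (hQ : Tendsto (fun n => variance (Q n) (hypergraphLaw p n) * (g n * g n)) atTop (𝓝 0))
    (hXY : Tendsto (fun n => cov[X n, Y n; hypergraphLaw p n] * (f n * g n)) atTop (𝓝 z)) :
    Tendsto (fun n => cov[X n + R n, Y n + Q n; hypergraphLaw p n] * (f n * g n))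
      atTop (𝓝 z) := by
  have h1 := tendsto_cov_mul_zero p hf hg hX hQ
  have h2 := tendsto_cov_mul_zero p hg hf hY hR
  have h3 := tendsto_cov_mul_zero p hf hg hR hQ
  have h := (hXY.add h1).add (h2.add h3)
  simp only [add_zero] at h
  refine h.congr fun n => ?_
  rw [covariance_add_left .of_discrete .of_discrete .of_discrete,
    covariance_add_right .of_discrete .of_discrete .of_discrete,
    covariance_add_right .of_discrete .of_discrete .of_discrete,
    covariance_comm (Y n) (R n)]
  ring

theorem cov_congr_ae {Ω : Type*} [MeasurableSpace Ω] {μ : Measure Ω} {X X' Y Y' : Ω → ℝ}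
    (hX : X =ᵐ[μ] X') (hY : Y =ᵐ[μ] Y') : cov[X, Y; μ] = cov[X', Y'; μ] := by
  rw [covariance, covariance, integral_congr_ae hX, integral_congr_ae hY]
  refine integral_congr_ae ?_
  filter_upwards [hX, hY] with ω h1 h2
  rw [h1, h2]

theorem variance_sub_le_of_finite {Ω : Type*} [Finite Ω] [MeasurableSpace Ω]
    [DiscreteMeasurableSpace Ω] (μ : Measure Ω) [IsProbabilityMeasure μ] (X Y : Ω → ℝ) :
    variance (X - Y) μ ≤ 2 * (variance X μ + variance Y μ) := by
  have h1 := variance_add (μ := μ) (X := X) (Y := Y) .of_discrete .of_discrete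
  have h2 := variance_sub (μ := μ) (X := X) (Y := Y) .of_discrete .of_discrete
  have h3 := variance_nonneg (X + Y) μ
  linarith

/-! ### Normalization of the critical counts -/

/-- The factor by which the number of critical simplices with `α + 1` vertices is multiplied. -/
def scale (k' α n : ℕ) : ℝ := Real.sqrt ((n : ℝ) ^ k') / (n : ℝ) ^ α

theorem scale_nonneg (k' α n : ℕ) : 0 ≤ scale k' α n := by
  unfold scale
  positivity

theorem scale_pos (k' α : ℕ) {n : ℕ} (hn : 0 < n) : 0 < scale k' α n := by
  unfold scale
  positivity

theorem scale_mul_scale (k' α β n : ℕ) :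
    scale k' α n * scale k' β n = (n : ℝ) ^ k' / (n : ℝ) ^ (α + β) := by
  rw [scale, scale, div_mul_div_comm, Real.mul_self_sqrt (by positivity), pow_add]

theorem tendsto_const_div_natCast (C : ℝ) :
    Tendsto (fun n : ℕ => C / (n : ℝ)) atTop (𝓝 0) :=
  tendsto_const_nhds.div_atTop tendsto_natCast_atTop_atTop

theorem tendsto_variance_unmatchedCount (p : ℕ → I) {k' α : ℕ} (hc0 : 0 < (p (k' + 1) : ℝ))
    (hc1 : (p (k' + 1) : ℝ) < 1) (hα : k' ≤ α) (hρ : 0 < rho p k' (α + 1)) :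
    Tendsto (fun n : ℕ => variance (unmatchedCount (k' + 2) α) (hypergraphLaw p n) *
      (scale k' α n * scale k' α n)) atTop (𝓝 (covLimit p k' α α)) := by
  refine (tendsto_cov_unmatchedCount p hc0 hc1 hα hα hρ hρ).congr fun n => ?_
  rw [covariance_self (Measurable.of_discrete).aemeasurable, scale_mul_scale, mul_div_assoc]

/-- Both counts have variance O(n^(2α-k')), while the normalization is that of level α+1, namely
n^(k'-2α-2). A factor n^(-2) is left over. -/
theorem tendsto_variance_remainder (p : ℕ → I) {k' α : ℕ} (hc0 : 0 < (p (k' + 1) : ℝ))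
    (hc1 : (p (k' + 1) : ℝ) < 1) (hα : k' ≤ α) (hρ : 0 < rho p k' (α + 1)) :
    Tendsto (fun n : ℕ =>
      variance (unmatchedCount (k' + 2) α - faceCount (k' + 2) (α + 1)) (hypergraphLaw p n) *
      (scale k' (α + 1) n * scale k' (α + 1) n)) atTop (𝓝 0) := by
  have h1 := tendsto_variance_unmatchedCount p hc0 hc1 hα hρ
  have h2 := (h1.mul (tendsto_const_div_natCast 1)).mul (tendsto_const_div_natCast 1)
  have h3 := (tendsto_const_div_natCast ((α + 1).choose (k' + 2))).mul (tendsto_const_div_natCast 1)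
  have h4 := (h2.add h3).const_mul 2
  simp only [mul_zero, add_zero] at h4
  refine squeeze_zero_norm' ?_ h4
  filter_upwards [eventually_gt_atTop 0] with n hn
  have hn' : (0 : ℝ) < n := by positivity
  have hV : variance (faceCount (k' + 2) (α + 1)) (hypergraphLaw p n) *
      ((n : ℝ) ^ k' / n ^ (α + 1 + (α + 1))) ≤ (α + 1).choose (k' + 2) / n * (1 / n) := by
    have := variance_faceCount_mul_le p (k' + 2) (α + 1) n
    rw [← mul_div_assoc, div_mul_div_comm, mul_one, div_le_div_iff₀ (by positivity)
      (by positivity)]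
    calc _ = variance (faceCount (k' + 2) (α + 1)) (hypergraphLaw p n) * (n : ℝ) ^ (k' + 2) := by
          ring
      _ ≤ _ := this
  have hU : variance (unmatchedCount (k' + 2) α) (hypergraphLaw p n) *
      ((n : ℝ) ^ k' / n ^ (α + 1 + (α + 1))) =
      variance (unmatchedCount (k' + 2) α) (hypergraphLaw p n) *
        (scale k' α n * scale k' α n) * (1 / n) * (1 / n) := by
    rw [scale_mul_scale]
    field_simp
    ring
  rw [Real.norm_of_nonneg (mul_nonneg (variance_nonneg _ _)
    (mul_nonneg (scale_nonneg _ _ _) (scale_nonneg _ _ _))), ← hU, scale_mul_scale]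
  calc _ ≤ 2 * (variance (unmatchedCount (k' + 2) α) (hypergraphLaw p n) +
        variance (faceCount (k' + 2) (α + 1)) (hypergraphLaw p n)) *
        ((n : ℝ) ^ k' / n ^ (α + 1 + (α + 1))) :=
        mul_le_mul_of_nonneg_right (variance_sub_le_of_finite _ _ _) (by positivity)
    _ ≤ _ := by linarith

/-! ### The case of a vanishing top parameter -/

/-- Each face indicator dominates the corresponding unmatched indicator and has the same mean,
because (1 - ρ)^w = 1. -/
theorem ae_unmatchedCount_eq_faceCount (p : ℕ → I) {k' α n : ℕ} (hρ : rho p k' (α + 1) = 0) :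
    unmatchedCount (k' + 2) α =ᵐ[hypergraphLaw p n] faceCount (k' + 2) (α + 1) := by
  have h : ∀ (w : Fin n) (A : Finset (Fin n)), A ∈ (Finset.Ioi w).powersetCard α →
      ∀ᵐ H ∂hypergraphLaw p n,
        unmatched (k' + 2) w A H = present (edgesIn (k' + 2) (insert w A)) H := by
    intro w A hA
    obtain ⟨hA1, hA2⟩ := Finset.mem_powersetCard.1 hA
    have hw : w ∉ A := fun h => lt_irrefl _ (Finset.mem_Ioi.1 (hA1 h))
    have hle : ∀ H, 0 ≤ present (edgesIn (k' + 2) (insert w A)) H - unmatched (k' + 2) w A H := by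
      intro H
      rw [sub_nonneg]
      refine mul_le_of_le_one_right (present_nonneg _ _) (Finset.prod_le_one (fun j _ => ?_)
        fun j _ => ?_)
      · linarith [present_le_one (cone (k' + 2) j (insert w A)) H]
      · linarith [present_nonneg (cone (k' + 2) j (insert w A)) H]
    have hint : ∫ H, (present (edgesIn (k' + 2) (insert w A)) H - unmatched (k' + 2) w A H)
        ∂hypergraphLaw p n = 0 := by
      rw [integral_sub .of_finite .of_finite, integral_unmatched p k' hA1, integral_present,
        prod_edgesIn, Finset.card_insert_of_notMem hw, hA2, hρ]
      simp
    have := (integral_eq_zero_iff_of_nonneg hle .of_finite).1 hint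
    filter_upwards [this] with H hH
    simp only [Pi.zero_apply] at hH
    linarith
  have h' : ∀ᵐ H ∂hypergraphLaw p n, ∀ (w : Fin n) (A : Finset (Fin n)),
      A ∈ (Finset.Ioi w).powersetCard α →
        unmatched (k' + 2) w A H = present (edgesIn (k' + 2) (insert w A)) H := by
    simp only [ae_all_iff]
    exact h
  filter_upwards [h'] with H hH
  rw [unmatchedCount, faceCount, sum_powersetCard_succ]
  exact Finset.sum_congr rfl fun w _ => Finset.sum_congr rfl fun A hA => hH w A hA

theorem tendsto_variance_unmatchedCount_of_rho_eq_zero (p : ℕ → I) {k' α : ℕ}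
    (hc0 : (p (k' + 1) : ℝ) ≠ 0) (hα : k' + 1 ≤ α) (hρ : rho p k' (α + 1) = 0) :
    Tendsto (fun n : ℕ => variance (unmatchedCount (k' + 2) α) (hypergraphLaw p n) *
      (scale k' α n * scale k' α n)) atTop
      (𝓝 (faceProb p k' (α + 1) * faceProb p k' (α + 1) * ((p (k' + 1) : ℝ)⁻¹ - 1) *
        ((α + 1).choose (k' + 2) /
          ((α + 1).factorial * (α + 1 - (k' + 2)).factorial)))) := by
  refine (tendsto_variance_faceCount p hc0 (by omega)).congr' ?_
  filter_upwards [eventually_gt_atTop 0] with n hn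
  rw [variance_congr (ae_unmatchedCount_eq_faceCount p hρ), scale_mul_scale]
  have : (n : ℝ) ≠ 0 := by positivity
  field_simp
  ring

/-- With faces in place of unmatched simplices on one side, the covariance is O(n^(α+β+1-(k'+2))),
one power of n below the normalization. -/
theorem tendsto_cov_unmatchedCount_of_rho_eq_zero (p : ℕ → I) {k' α β : ℕ}
    (hρα : 0 < rho p k' (α + 1)) (hρα' : rho p k' (α + 1) ≤ 1) (hρβ : rho p k' (β + 1) = 0) :
    Tendsto (fun n : ℕ => cov[unmatchedCount (k' + 2) α, unmatchedCount (k' + 2) β;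
      hypergraphLaw p n] * (scale k' α n * scale k' β n)) atTop (𝓝 0) := by
  obtain ⟨C, hC⟩ := exists_abs_cov_unmatchedCount_faceCount_le p hρα hρα' (β + 1)
  refine squeeze_zero_norm' ?_ (tendsto_const_div_natCast C)
  filter_upwards [eventually_gt_atTop 0] with n hn
  have hn' : (0 : ℝ) < n := by positivity
  have hae : cov[unmatchedCount (k' + 2) α, unmatchedCount (k' + 2) β; hypergraphLaw p n] =
      cov[unmatchedCount (k' + 2) α, faceCount (k' + 2) (β + 1); hypergraphLaw p n] :=
    cov_congr_ae (.refl _ _) (ae_unmatchedCount_eq_faceCount p hρβ)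
  rw [Real.norm_eq_abs, abs_mul, hae, scale_mul_scale,
    abs_of_pos (a := (n : ℝ) ^ k' / (n : ℝ) ^ (α + β)) (by positivity), ← mul_div_assoc,
    div_le_div_iff₀ (by positivity) hn']
  have h1 := hC n
  rw [show (n : ℝ) ^ (k' + 2) = n ^ k' * n * n by ring,
    show (n : ℝ) ^ (α + (β + 1)) = n ^ (α + β) * n by ring] at h1
  refine le_of_mul_le_mul_right ?_ hn'
  linarith

/-! ### Algebra of the limit -/

theorem denom_pos {x y c : ℝ} (hx : 0 < x) (hxc : x ≤ c) (hy : 0 ≤ y) :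
    0 < x + y - x * y / c := by
  have hc : 0 < c := hx.trans_le hxc
  have : x * y / c ≤ y := by
    rw [div_le_iff₀ hc]
    nlinarith
  linarith

theorem corr_nonneg {x y c : ℝ} (hx : 0 < x) (hxc : x ≤ c) (hy : 0 ≤ y) (hc1 : c < 1) :
    0 ≤ x * y * Real.sqrt ((2 - x) * (2 - y) * (2 - x * c⁻¹) * (2 - y * c⁻¹)) /
      ((x + y - x * y * c⁻¹) * (x + y - x * y)) := by
  have h1 := denom_pos hx hxc hy
  have h2 := denom_pos hx (hxc.trans hc1.le) hy
  rw [div_one] at h2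
  rw [div_eq_mul_inv] at h1
  positivity

/-- After squaring, the left side is a product of two factors, each short of the corresponding
squared denominator factor by exactly (x - y)² > 0. -/
theorem corr_lt_one {x y c : ℝ} (hx : 0 < x) (hxc : x ≤ c) (hy : 0 ≤ y) (hyx : y < x)
    (hc1 : c < 1) :
    x * y * Real.sqrt ((2 - x) * (2 - y) * (2 - x * c⁻¹) * (2 - y * c⁻¹)) /
      ((x + y - x * y * c⁻¹) * (x + y - x * y)) < 1 := by
  have hc : 0 < c := hx.trans_le hxc
  have h1 := denom_pos hx hxc hy
  have h2 := denom_pos hx (hxc.trans hc1.le) hy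
  rw [div_one] at h2
  rw [div_eq_mul_inv] at h1
  have hxc' : x * c⁻¹ ≤ 1 := by rw [← div_eq_mul_inv, div_le_one hc]; exact hxc
  have hyc' : y * c⁻¹ ≤ 1 := by rw [← div_eq_mul_inv, div_le_one hc]; linarith
  set d := c⁻¹
  rw [div_lt_one (mul_pos h1 h2)]
  have hg : 0 ≤ (2 - x) * (2 - y) * (2 - x * d) * (2 - y * d) :=
    mul_nonneg (mul_nonneg (mul_nonneg (by linarith) (by linarith)) (by linarith)) (by linarith)
  refine lt_of_pow_lt_pow_left₀ 2 (mul_pos h1 h2).le ?_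
  rw [mul_pow, Real.sq_sqrt hg]
  have hA : x * y * ((2 - x) * (2 - y)) = (x + y - x * y) ^ 2 - (x - y) ^ 2 := by ring
  have hB : x * y * ((2 - x * d) * (2 - y * d)) = (x + y - x * y * d) ^ 2 - (x - y) ^ 2 := by ring
  have hpos : 0 < (x - y) ^ 2 := pow_pos (by linarith) 2
  have hA0 : 0 ≤ x * y * ((2 - x) * (2 - y)) :=
    mul_nonneg (mul_nonneg hx.le hy) (mul_nonneg (by linarith) (by linarith))
  calc (x * y) ^ 2 * ((2 - x) * (2 - y) * (2 - x * d) * (2 - y * d))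
      = (x * y * ((2 - x * d) * (2 - y * d))) * (x * y * ((2 - x) * (2 - y))) := by ring
    _ ≤ (x + y - x * y * d) ^ 2 * (x * y * ((2 - x) * (2 - y))) :=
        mul_le_mul_of_nonneg_right (by linarith) hA0
    _ < (x + y - x * y * d) ^ 2 * (x + y - x * y) ^ 2 :=
        mul_lt_mul_of_pos_left (by linarith) (pow_pos h1 2)
    _ = _ := by ring

/-- All exponents grow with a, and by Pascal's rule that of p_{k'+1} grows by at least one. -/
theorem rho_le_mul_rho (p : ℕ → I) {k' a b : ℕ} (ha : k' + 1 ≤ a) (hab : a < b) :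
    rho p k' b ≤ p (k' + 1) * rho p k' a := by
  have h1 : rho p k' a = ∏ i ∈ Finset.Icc (k' + 1) b, (p i : ℝ) ^ a.choose i := by
    refine Finset.prod_subset (Finset.Icc_subset_Icc le_rfl hab.le) fun i hi hi' => ?_
    have h2 := Finset.mem_Icc.1 hi
    rw [Finset.mem_Icc, not_and] at hi'
    rw [Nat.choose_eq_zero_of_lt (not_le.1 (hi' h2.1)), pow_zero]
  have h2 : (p (k' + 1) : ℝ) =
      ∏ i ∈ Finset.Icc (k' + 1) b, if i = k' + 1 then (p i : ℝ) else 1 := by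
    rw [Finset.prod_ite_eq', if_pos (Finset.mem_Icc.2 ⟨le_rfl, by omega⟩)]
  rw [h1, h2, ← Finset.prod_mul_distrib]
  refine Finset.prod_le_prod (fun i _ => pow_nonneg (p i).2.1 _) fun i hi => ?_
  have hmono : a.choose i ≤ b.choose i := Nat.choose_le_choose i hab.le
  split_ifs with h
  · subst h
    rw [← pow_succ']
    refine pow_le_pow_of_le_one (p _).2.1 (p _).2.2 ?_
    have h3 : (a + 1).choose (k' + 1) ≤ b.choose (k' + 1) := Nat.choose_le_choose _ hab
    rw [Nat.choose_succ_succ'] at h3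
    have h4 : 0 < a.choose k' := Nat.choose_pos (by omega)
    omega
  · rw [one_mul]
    exact pow_le_pow_of_le_one (p _).2.1 (p _).2.2 hmono

/-- This form splits off one factor depending only on α and one only on β, which cancel in the
correlation. -/
theorem covLimit_eq (p : ℕ → I) {k' α β : ℕ} (hα : k' ≤ α) (hc1 : (p (k' + 1) : ℝ) < 1)
    (hρα : 0 < rho p k' (α + 1)) (hρβ : 0 ≤ rho p k' (β + 1)) :
    covLimit p k' α β = faceProb p k' (α + 1) / (α - k').factorial *
      (faceProb p k' (β + 1) / (β - k').factorial) *
      (rho p k' (α + 1) * rho p k' (β + 1) * ((p (k' + 1) : ℝ)⁻¹ - 1) / k'.factorial /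
        ((rho p k' (α + 1) + rho p k' (β + 1) -
          rho p k' (α + 1) * rho p k' (β + 1) * (p (k' + 1) : ℝ)⁻¹) *
          (rho p k' (α + 1) + rho p k' (β + 1) - rho p k' (α + 1) * rho p k' (β + 1)))) := by
  have hα1 : rho p k' (α + 1) ≤ p (k' + 1) := rho_le p (by omega)
  have h1 := denom_pos hρα hα1 hρβ
  have h2 := denom_pos hρα (hα1.trans hc1.le) hρβ
  rw [div_one] at h2
  have hchoose : (α.choose k' : ℝ) = α.factorial / (k'.factorial * (α - k').factorial) :=
    Nat.cast_choose ℝ hα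
  rw [covLimit, rho_self, hchoose, inv_sub_inv h1.ne' h2.ne', ← div_eq_mul_inv _ (p (k' + 1) : ℝ)]
  have hf1 : (α.factorial : ℝ) ≠ 0 := by positivity
  have hf2 : (k'.factorial : ℝ) ≠ 0 := by positivity
  have hf3 : ((α - k').factorial : ℝ) ≠ 0 := by positivity
  have hf4 : ((β - k').factorial : ℝ) ≠ 0 := by positivity
  have hc0 : (p (k' + 1) : ℝ) ≠ 0 := (hρα.trans_le hα1).ne'
  generalize hD1 : rho p k' (α + 1) + rho p k' (β + 1) -
    rho p k' (α + 1) * rho p k' (β + 1) / (p (k' + 1) : ℝ) = D1 at h1 ⊢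
  generalize hD2 : rho p k' (α + 1) + rho p k' (β + 1) -
    rho p k' (α + 1) * rho p k' (β + 1) = D2 at h2 ⊢
  have hD : D2 - D1 = rho p k' (α + 1) * rho p k' (β + 1) * ((p (k' + 1) : ℝ)⁻¹ - 1) := by
    rw [← hD1, ← hD2]
    ring
  rw [hD]
  field_simp

theorem covLimit_self_eq (p : ℕ → I) {k' α : ℕ} (hα : k' ≤ α) (hc1 : (p (k' + 1) : ℝ) < 1)
    (hρ : 0 < rho p k' (α + 1)) :
    covLimit p k' α α = (faceProb p k' (α + 1) / (α - k').factorial) ^ 2 *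
      (((p (k' + 1) : ℝ)⁻¹ - 1) / k'.factorial /
        ((2 - rho p k' (α + 1) * (p (k' + 1) : ℝ)⁻¹) * (2 - rho p k' (α + 1)))) := by
  have hα1 : rho p k' (α + 1) ≤ p (k' + 1) := rho_le p (by omega)
  rw [covLimit_eq p hα hc1 hρ hρ.le]
  have h : ∀ x d e : ℝ, x ≠ 0 → x * x * d / k'.factorial / ((x + x - x * x * e) * (x + x - x * x)) =
      d / k'.factorial / ((2 - x * e) * (2 - x)) := by
    intro x d e hx
    rw [show (x + x - x * x * e) * (x + x - x * x) = (x * x) * ((2 - x * e) * (2 - x)) by ring,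
      mul_div_assoc, mul_div_mul_left _ _ (mul_ne_zero hx hx)]
  rw [h _ _ _ hρ.ne', sq]

theorem covLimit_self_pos (p : ℕ → I) {k' α : ℕ} (hα : k' ≤ α) (hc1 : (p (k' + 1) : ℝ) < 1)
    (hρ : 0 < rho p k' (α + 1)) (hP : 0 < faceProb p k' (α + 1)) : 0 < covLimit p k' α α := by
  have hα1 : rho p k' (α + 1) ≤ p (k' + 1) := rho_le p (by omega)
  have hc0 : 0 < (p (k' + 1) : ℝ) := hρ.trans_le hα1
  have hxc : rho p k' (α + 1) * (p (k' + 1) : ℝ)⁻¹ ≤ 1 := by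
    rw [← div_eq_mul_inv, div_le_one hc0]; exact hα1
  have h1 : 0 < (p (k' + 1) : ℝ)⁻¹ - 1 := by
    have := (one_lt_inv₀ hc0).2 hc1
    linarith
  have h2 : 0 < 2 - rho p k' (α + 1) * (p (k' + 1) : ℝ)⁻¹ := by linarith
  have h3 : 0 < 2 - rho p k' (α + 1) := by linarith
  rw [covLimit_self_eq p hα hc1 hρ]
  positivity

/-- The face probabilities, the factorials and (c⁻¹ - 1)/k'! cancel. The diagonal denominators (2 -
x/c)(2 - x) and (2 - y/c)(2 - y) supply the square root in the numerator. -/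
theorem limitCorr_eq (p : ℕ → I) {k' α β : ℕ} (hα : k' ≤ α) (hβ : k' ≤ β)
    (hc1 : (p (k' + 1) : ℝ) < 1) (hρα : 0 < rho p k' (α + 1)) (hρβ : 0 < rho p k' (β + 1))
    (hPα : 0 < faceProb p k' (α + 1)) (hPβ : 0 < faceProb p k' (β + 1)) :
    (Real.sqrt (covLimit p k' α α))⁻¹ * (Real.sqrt (covLimit p k' β β))⁻¹ * covLimit p k' α β =
      limitCorr p k' α β := by
  have hα1 : rho p k' (α + 1) ≤ p (k' + 1) := rho_le p (by omega)
  have hβ1 : rho p k' (β + 1) ≤ p (k' + 1) := rho_le p (by omega)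
  have hc0 : 0 < (p (k' + 1) : ℝ) := hρα.trans_le hα1
  have hxc : rho p k' (α + 1) * (p (k' + 1) : ℝ)⁻¹ ≤ 1 := by
    rw [← div_eq_mul_inv, div_le_one hc0]; exact hα1
  have hyc : rho p k' (β + 1) * (p (k' + 1) : ℝ)⁻¹ ≤ 1 := by
    rw [← div_eq_mul_inv, div_le_one hc0]; exact hβ1
  have hd : 0 < ((p (k' + 1) : ℝ)⁻¹ - 1) / k'.factorial := by
    have := (one_lt_inv₀ hc0).2 hc1
    have : 0 < (p (k' + 1) : ℝ)⁻¹ - 1 := by linarith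
    positivity
  have hden : covLimit p k' α β = _ := covLimit_eq p hα hc1 hρα hρβ.le
  rw [hden, covLimit_self_eq p hα hc1 hρα, covLimit_self_eq p hβ hc1 hρβ, limitCorr, rho_self,
    Real.sqrt_mul (by positivity), Real.sqrt_mul (by positivity), Real.sqrt_sq (by positivity),
    Real.sqrt_sq (by positivity), Real.sqrt_div hd.le, Real.sqrt_div hd.le]
  set x := rho p k' (α + 1)
  set y := rho p k' (β + 1)
  set d := ((p (k' + 1) : I) : ℝ)⁻¹
  set P := faceProb p k' (α + 1) / (α - k').factorial
  set Q := faceProb p k' (β + 1) / (β - k').factorial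
  have hP : 0 < P := by positivity
  have hQ : 0 < Q := by positivity
  have hX : 0 < (2 - x * d) * (2 - x) := mul_pos (by linarith) (by linarith)
  have hY : 0 < (2 - y * d) * (2 - y) := mul_pos (by linarith) (by linarith)
  rw [show (2 - x) * (2 - y) * (2 - x * d) * (2 - y * d) =
    ((2 - x * d) * (2 - x)) * ((2 - y * d) * (2 - y)) by ring, Real.sqrt_mul hX.le,
    mul_div_assoc (x * y)]
  set e := (d - 1) / k'.factorial
  have he := Real.mul_self_sqrt hd.le
  have he0 := Real.sqrt_pos.2 hd
  have hX0 := Real.sqrt_pos.2 hX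
  have hY0 := Real.sqrt_pos.2 hY
  set r := Real.sqrt e
  set u := Real.sqrt ((2 - x * d) * (2 - x))
  set v := Real.sqrt ((2 - y * d) * (2 - y))
  set D := (x + y - x * y * d) * (x + y - x * y)
  rw [← he]
  field_simp

/-! ### The limit of the correlations -/

theorem tendsto_cov_critCount (p : ℕ → I) {k' : ℕ} (hone : ∀ l, 1 ≤ l → l ≤ k' → p l = 1)
    (hc0 : 0 < (p (k' + 1) : ℝ)) (hc1 : (p (k' + 1) : ℝ) < 1) {α β : ℕ} (hα : k' ≤ α)
    (hβ : k' ≤ β) (hρα : 0 < rho p k' (α + 1)) (hρβ : 0 < rho p k' (β + 1)) {u v z : ℝ}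
    (hu : Tendsto (fun n => variance (unmatchedCount (k' + 2) (α + 1)) (hypergraphLaw p n) *
      (scale k' (α + 1) n * scale k' (α + 1) n)) atTop (𝓝 u))
    (hv : Tendsto (fun n => variance (unmatchedCount (k' + 2) (β + 1)) (hypergraphLaw p n) *
      (scale k' (β + 1) n * scale k' (β + 1) n)) atTop (𝓝 v))
    (hz : Tendsto (fun n => cov[unmatchedCount (k' + 2) (α + 1), unmatchedCount (k' + 2) (β + 1);
      hypergraphLaw p n] * (scale k' (α + 1) n * scale k' (β + 1) n)) atTop (𝓝 z)) :
    Tendsto (fun n => cov[critCount (α + 2), critCount (β + 2); hypergraphLaw p n] *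
      (scale k' (α + 1) n * scale k' (β + 1) n)) atTop (𝓝 z) := by
  refine (tendsto_cov_add_add p (scale_nonneg _ _) (scale_nonneg _ _) hu hv
    (tendsto_variance_remainder p hc0 hc1 hα hρα) (tendsto_variance_remainder p hc0 hc1 hβ hρβ)
    hz).congr fun n => ?_
  rw [cov_congr_ae (ae_critCount_eq p hone α) (ae_critCount_eq p hone β)]
  rfl

theorem tendsto_critVar (p : ℕ → I) {k' : ℕ} (hone : ∀ l, 1 ≤ l → l ≤ k' → p l = 1)
    (hc0 : 0 < (p (k' + 1) : ℝ)) (hc1 : (p (k' + 1) : ℝ) < 1) {α : ℕ} (hα : k' ≤ α)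
    (hρα : 0 < rho p k' (α + 1)) {u : ℝ}
    (hu : Tendsto (fun n => variance (unmatchedCount (k' + 2) (α + 1)) (hypergraphLaw p n) *
      (scale k' (α + 1) n * scale k' (α + 1) n)) atTop (𝓝 u)) :
    Tendsto (fun n => critVar p n (α + 2) * (scale k' (α + 1) n * scale k' (α + 1) n))
      atTop (𝓝 u) := by
  refine (tendsto_cov_critCount p hone hc0 hc1 hα hα hρα hρα hu hu (hu.congr fun n => ?_)).congr
    fun n => ?_
  · rw [covariance_self (Measurable.of_discrete).aemeasurable]
  · rw [covariance_self (Measurable.of_discrete).aemeasurable, critVar]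

theorem eventually_critVar_pos (p : ℕ → I) {k' α a : ℕ} {u : ℝ} (hu0 : 0 < u)
    (hu : Tendsto (fun n => critVar p n a * (scale k' α n * scale k' α n)) atTop (𝓝 u)) :
    ∀ᶠ n in atTop, 0 < critVar p n a := by
  filter_upwards [hu.eventually_const_lt hu0] with n hn
  exact pos_of_mul_pos_left hn (mul_nonneg (scale_nonneg _ _ _) (scale_nonneg _ _ _))

theorem tendsto_critCorr (p : ℕ → I) {k' α β a b : ℕ} {u v z : ℝ} (hu0 : 0 < u) (hv0 : 0 < v)
    (hu : Tendsto (fun n => critVar p n a * (scale k' α n * scale k' α n)) atTop (𝓝 u))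
    (hv : Tendsto (fun n => critVar p n b * (scale k' β n * scale k' β n)) atTop (𝓝 v))
    (hz : Tendsto (fun n => cov[critCount a, critCount b; hypergraphLaw p n] *
      (scale k' α n * scale k' β n)) atTop (𝓝 z)) :
    Tendsto (fun n => critCorr p n a b) atTop (𝓝 ((Real.sqrt u)⁻¹ * (Real.sqrt v)⁻¹ * z)) := by
  have h := ((hu.sqrt.inv₀ (Real.sqrt_pos.2 hu0).ne').mul
    (hv.sqrt.inv₀ (Real.sqrt_pos.2 hv0).ne')).mul hz
  refine h.congr' ?_
  filter_upwards [eventually_gt_atTop 0] with n hn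
  have h1 := scale_pos k' α hn
  have h2 := scale_pos k' β hn
  rw [Real.sqrt_mul (x := critVar p n a) (variance_nonneg _ _),
    Real.sqrt_mul (x := critVar p n b) (variance_nonneg _ _),
    Real.sqrt_mul_self h1.le, Real.sqrt_mul_self h2.le, critCorr, mul_inv, mul_inv]
  field_simp

end

end LexMorse

theorem mainTheorem5 (p : ℕ → I) (k' : ℕ)
    (hone : ∀ l, 1 ≤ l → l ≤ k' → p l = 1) (hmax : p (k' + 1) ≠ 1)
    (i j : ℕ) (hi : 1 ≤ i) (hij : i < j)
    (hpos : ∀ l, 1 ≤ l → l ≤ k' + j → p l ≠ 0) :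
    (∀ᶠ n in atTop,
      0 < LexMorse.critVar p n (k' + i + 1) ∧ 0 < LexMorse.critVar p n (k' + j + 1)) ∧
    Tendsto (fun n : ℕ => LexMorse.critCorr p n (k' + i + 1) (k' + j + 1)) atTop
      (𝓝 (LexMorse.limitCorr p k' (k' + i) (k' + j))) ∧
    0 ≤ LexMorse.limitCorr p k' (k' + i) (k' + j) ∧
    ((∀ l, k' < l → 0 < (p l : ℝ) ∧ (p l : ℝ) < 1) →
      LexMorse.limitCorr p k' (k' + i) (k' + j) < 1) := by
  have hc0' : 0 < p (k' + 1) := unitInterval.pos_iff_ne_zero.2 (hpos _ (by omega) (by omega))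
  have hc0 : 0 < (p (k' + 1) : ℝ) := hc0'
  have hc1 : (p (k' + 1) : ℝ) < 1 := unitInterval.lt_one_iff_ne_one.2 hmax
  -- With i = i' + 1 the vertex count k + 1 is (k' + i') + 2, the form α + 2 with α ≥ k' needed for
  -- the decomposition and the remainder bound.
  obtain ⟨i, rfl⟩ : ∃ i', i = i' + 1 := ⟨i - 1, by omega⟩
  obtain ⟨j, rfl⟩ : ∃ j', j = j' + 1 := ⟨j - 1, by omega⟩
  have hρ : ∀ a, a ≤ k' + (j + 1) → 0 < LexMorse.rho p k' a := fun a ha =>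
    LexMorse.rho_pos p fun l hl hla => hpos l (by omega) (by omega)
  have hP : ∀ a, a ≤ k' + (j + 1) + 1 → 0 < LexMorse.faceProb p k' a := fun a ha =>
    LexMorse.faceProb_pos p fun l hl hla => hpos l (by omega) (by omega)
  have hxc := LexMorse.rho_le p (k' := k') (a := k' + (i + 1) + 1) (by omega)
  have hyx := LexMorse.rho_le_mul_rho p (k' := k') (a := k' + (i + 1) + 1)
    (b := k' + (j + 1) + 1) (by omega) (by omega)
  have hx := hρ (k' + (i + 1) + 1) (by omega)
  have hy := LexMorse.rho_nonneg p k' (k' + (j + 1) + 1)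
  have hu := LexMorse.tendsto_variance_unmatchedCount p hc0 hc1 (α := k' + i + 1) (by omega) hx
  have hu0 := LexMorse.covLimit_self_pos p (α := k' + i + 1) (by omega) hc1 hx (hP _ (by omega))
  have hTu := LexMorse.tendsto_critVar p hone hc0 hc1 (α := k' + i) (by omega)
    (hρ _ (by omega)) hu
  have key : ∃ v z : ℝ, 0 < v ∧
      Tendsto (fun n => variance (LexMorse.unmatchedCount (k' + 2) (k' + j + 1))
        (LexMorse.hypergraphLaw p n) * (LexMorse.scale k' (k' + j + 1) n *
          LexMorse.scale k' (k' + j + 1) n)) atTop (𝓝 v) ∧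
      Tendsto (fun n => cov[LexMorse.unmatchedCount (k' + 2) (k' + i + 1),
        LexMorse.unmatchedCount (k' + 2) (k' + j + 1); LexMorse.hypergraphLaw p n] *
          (LexMorse.scale k' (k' + i + 1) n * LexMorse.scale k' (k' + j + 1) n)) atTop (𝓝 z) ∧
      (Real.sqrt (LexMorse.covLimit p k' (k' + i + 1) (k' + i + 1)))⁻¹ * (Real.sqrt v)⁻¹ * z =
        LexMorse.limitCorr p k' (k' + (i + 1)) (k' + (j + 1)) := by
    -- Positivity is known only up to p_r, whereas ρ(r+1) contains p_{r+1} and may be 0. The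
    -- variance limit stays positive in that case, since the face probability of r+1 vertices
    -- involves no parameter beyond p_r.
    rcases hy.eq_or_lt with hy0 | hy0
    · refine ⟨_, 0, ?_, LexMorse.tendsto_variance_unmatchedCount_of_rho_eq_zero p hc0.ne'
        (by omega) hy0.symm, LexMorse.tendsto_cov_unmatchedCount_of_rho_eq_zero p hx
          (hxc.trans hc1.le) hy0.symm, ?_⟩
      · have h1 := hP (k' + j + 1 + 1) (by omega)
        have h2 : 0 < (p (k' + 1) : ℝ)⁻¹ - 1 := sub_pos.2 ((one_lt_inv₀ hc0).2 hc1)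
        have h3 : 0 < (k' + j + 1 + 1).choose (k' + 2) := Nat.choose_pos (by omega)
        positivity
      · rw [LexMorse.limitCorr, ← hy0]
        simp
    · refine ⟨_, _, LexMorse.covLimit_self_pos p (by omega) hc1 hy0 (hP _ (by omega)),
        LexMorse.tendsto_variance_unmatchedCount p hc0 hc1 (by omega) hy0, ?_,
        LexMorse.limitCorr_eq p (α := k' + i + 1) (by omega) (by omega) hc1 hx hy0
          (hP _ (by omega)) (hP _ (by omega))⟩
      refine (LexMorse.tendsto_cov_unmatchedCount p hc0 hc1 (by omega) (by omega) hx hy0).congr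
        fun n => ?_
      rw [LexMorse.scale_mul_scale, mul_div_assoc]
      rfl
  obtain ⟨v, z, hv0, hv, hz, hval⟩ := key
  have hTv := LexMorse.tendsto_critVar p hone hc0 hc1 (α := k' + j) (by omega)
    (hρ _ (by omega)) hv
  have hTz := LexMorse.tendsto_cov_critCount p hone hc0 hc1 (α := k' + i) (β := k' + j)
    (by omega) (by omega) (hρ _ (by omega)) (hρ _ (by omega)) hu hv hz
  refine ⟨?_, ?_, ?_, fun _ => ?_⟩
  · exact (LexMorse.eventually_critVar_pos p hu0 hTu).and
      (LexMorse.eventually_critVar_pos p hv0 hTv)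
  · rw [← hval]
    exact LexMorse.tendsto_critCorr p hu0 hv0 hTu hTv hTz
  · rw [LexMorse.limitCorr, LexMorse.rho_self]
    exact LexMorse.corr_nonneg hx hxc hy hc1
  · rw [LexMorse.limitCorr, LexMorse.rho_self]
    refine LexMorse.corr_lt_one hx hxc hy (hyx.trans_lt ?_) hc1
    exact mul_lt_of_lt_one_left hx hc1
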